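/- Conventions, all formalized in second-order arithmetic. A Boolean relation is a (coded) set $R\subseteq\{0,1\}^n$; for a class $S$ of Boolean relations, an $S$-formula over a set $V$ of variables is an expression $R(y_1,\dots,y_n)$ with $R\in S$ and $y_1,\dots,y_n\in V$. A set $C$ of formulas is finitely satisfiable if every finite subset of $C$ is satisfied by some truth assignment. A set $H$ of variables is homogeneous for $C$ if there is $c\in\{0,1\}$ such that every finite subset of $C$ is satisfied by a truth assignment $\nu$ with $\nu(a)=c$ for all $a\in H$. $\mathsf{LRSAT}(S)$ is the statement: for every infinite set $V$ of variables, every finitely satisfiable set $C$ of $S$-formulas over $V$ and every infinite set $L\subseteq V$, there is an infinite set $H\subseteq L$ homogeneous for $C$. $\mathsf{RSAT}(S)$ is the same statement restricted to $L=V$. A class $S$ of Boolean relations is a co-clone if it contains every relation defined by a formula $(\exists \vec y)\bigwedge F$ where $F$ is a finite set of formulas over $S\cup\{[x=y]\}$. A relation is affine if it is defined by a finite conjunction of equations $x_{1}\oplus\dots\oplus x_{k}=i$ with $i\in\{0,1\}$, and bijunctive if it is defined by a finite conjunction of clauses with at most two literals each. Theorem. $\mathsf{RCA}_0$ proves the following: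 if $S$ is a co-clone that is $\Sigma^0_1$ (defined by a $\Sigma^0_1$ formula, with number and set parameters allowed), then $\mathsf{RSAT}(S)\leftrightarrow\mathsf{LRSAT}(S)$. Moreover, $\mathsf{RCA}_0$ proves $\mathsf{RSAT}(\mathrm{affine})\leftrightarrow\mathsf{LRSAT}(\mathrm{affine})$ and $\mathsf{RSAT}(\mathrm{bijunctive})\leftrightarrow\mathsf{LRSAT}(\mathrm{bijunctive})$, where the two classes are those of all affine and of all bijunctive relations. -/

import Mathlib

universe u

/-! ### Second-order arithmetic and its subsystem `RCA₀` -/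

/-- A (Henkin) structure for the language of second-order arithmetic: a first-order part with
`0, 1, +, ·, <`, and a nonempty family of subsets of it over which the set variables range. -/
structure L2Structure where
  carrier : Type u
  zero : carrier
  one : carrier
  add : carrier → carrier → carrier
  mul : carrier → carrier → carrier
  lt : carrier → carrier → Prop
  sets : Set (Set carrier)
  sets_nonempty : sets.Nonempty

namespace L2Structure

instance : CoeSort L2Structure.{u} (Type u) := ⟨carrier⟩

instance (𝔐 : L2Structure.{u}) : Zero 𝔐 := ⟨𝔐.zero⟩
instance (𝔐 : L2Structure.{u}) : One 𝔐 := ⟨𝔐.one⟩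
instance (𝔐 : L2Structure.{u}) : Add 𝔐 := ⟨𝔐.add⟩
instance (𝔐 : L2Structure.{u}) : Mul 𝔐 := ⟨𝔐.mul⟩
instance (𝔐 : L2Structure.{u}) : LT 𝔐 := ⟨𝔐.lt⟩

end L2Structure

/-- Numerical terms; number variables are indexed by `ℕ`. -/
inductive L2Term : Type
  | var (x : ℕ)
  | zero
  | one
  | add (s t : L2Term)
  | mul (s t : L2Term)

/-- Bounded-quantifier formulas of second-order arithmetic: atomic formulas `s = t`, `s < t`,
`t ∈ X` (set variables are indexed by `ℕ`), propositional connectives, and bounded number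
quantifiers `(∀ x < t) φ`. -/
inductive L2BddFormula : Type
  | eq (s t : L2Term)
  | lt (s t : L2Term)
  | mem (t : L2Term) (X : ℕ)
  | neg (φ : L2BddFormula)
  | and (φ ψ : L2BddFormula)
  | ball (x : ℕ) (t : L2Term) (φ : L2BddFormula)

namespace L2Structure

variable (𝔐 : L2Structure.{u})

/-- Value of a term under the assignment `v` of number variables. -/
def termVal (v : ℕ → 𝔐) : L2Term → 𝔐
  | .var x => v x
  | .zero => 0
  | .one => 1
  | .add s t => termVal v s + termVal v t
  | .mul s t => termVal v s * termVal v t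

/-- Satisfaction of a bounded-quantifier formula, `v` assigning the number variables and `V` the
set variables. -/
def Realize (V : ℕ → Set 𝔐) : L2BddFormula → (ℕ → 𝔐) → Prop
  | .eq s t, v => 𝔐.termVal v s = 𝔐.termVal v t
  | .lt s t, v => 𝔐.termVal v s < 𝔐.termVal v t
  | .mem t X, v => 𝔐.termVal v t ∈ V X
  | .neg φ, v => ¬ Realize V φ v
  | .and φ ψ, v => Realize V φ v ∧ Realize V ψ v
  | .ball x t φ, v => ∀ a : 𝔐, a < 𝔐.termVal v t → Realize V φ (Function.update v x a)

/-- The class `P` of numbers of the structure is defined by a `Σ⁰₁` formula `∃ m, θ(n, m)`, with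
number and set parameters from the structure: `θ` is a bounded-quantifier formula, in which the
variable `0` stands for `n`, the variable `1` for `m`, and all others are parameters. -/
def IsSigma01 (P : Set 𝔐) : Prop :=
  ∃ (θ : L2BddFormula) (v : ℕ → 𝔐) (V : ℕ → Set 𝔐), (∀ i, V i ∈ 𝔐.sets) ∧
    ∀ n : 𝔐, n ∈ P ↔
      ∃ m : 𝔐, 𝔐.Realize V θ (Function.update (Function.update v 0 n) 1 m)

/-- The structure is a model of `RCA₀`: the basic axioms, `Σ⁰₁` induction, and `Δ⁰₁`
comprehension (a class is `Δ⁰₁` if it and its complement are `Σ⁰₁`). -/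
structure ModelsRCA₀ : Prop where
  succ_ne_zero : ∀ n : 𝔐, n + 1 ≠ 0
  succ_inj : ∀ m n : 𝔐, m + 1 = n + 1 → m = n
  add_zero : ∀ m : 𝔐, m + 0 = m
  add_succ : ∀ m n : 𝔐, m + (n + 1) = (m + n) + 1
  mul_zero : ∀ m : 𝔐, m * 0 = 0
  mul_succ : ∀ m n : 𝔐, m * (n + 1) = m * n + m
  not_lt_zero : ∀ m : 𝔐, ¬ m < 0
  lt_succ_iff : ∀ m n : 𝔐, m < n + 1 ↔ m < n ∨ m = n
  sigma01_induction : ∀ P : Set 𝔐, 𝔐.IsSigma01 P → 0 ∈ P → (∀ n ∈ P, n + 1 ∈ P) → ∀ n, n ∈ P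
  delta01_comprehension : ∀ P : Set 𝔐, 𝔐.IsSigma01 P → 𝔐.IsSigma01 Pᶜ → P ∈ 𝔐.sets

/-! ### Coding of finite objects, inside a structure

All notions below are relative to the structure: number quantifiers range over its first-order
part, set quantifiers over its family of sets. -/

variable {𝔐}

/-- The pairing function. -/
def pair (a b : 𝔐) : 𝔐 := (a + b) * (a + b) + a

/-- `i` is an element of the finite set coded by the number `c`. -/
def Elem (i c : 𝔐) : Prop :=
  ∃ k m n : 𝔐, c = pair k (pair m n) ∧ i < k ∧ ∃ q : 𝔐, n = (m * (i + 1) + 1) * q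

/-- `c` is the canonical, that is the least, code of the finite set that it codes. -/
def IsCode (c : 𝔐) : Prop :=
  ∀ c' : 𝔐, c' < c → ∃ i : 𝔐, ¬ (Elem i c' ↔ Elem i c)

/-- `s` is the code of a finite sequence of length `n`, as a finite set of pairs
`(i, yᵢ)`, `i < n`. -/
def IsSeq (n s : 𝔐) : Prop :=
  IsCode s ∧ (∀ z, Elem z s → ∃ i y : 𝔐, i < n ∧ z = pair i y) ∧
    ∀ i, i < n → ∃! y : 𝔐, Elem (pair i y) s

/-- `v` is the code of a vector in `{0,1}ⁿ`, given as the finite set of those `i < n` at which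
the vector is true. -/
def IsVec (n v : 𝔐) : Prop := IsCode v ∧ ∀ i, Elem i v → i < n

/-- `R` is the code of a finite set of vectors in `{0,1}ⁿ`. -/
def IsVecSet (n R : 𝔐) : Prop := IsCode R ∧ ∀ v, Elem v R → IsVec n v

variable (𝔐) in
/-- The class of codes `(n, R)` of Boolean relations `R ⊆ {0,1}ⁿ`. -/
def boolRels : Set 𝔐 := {r | ∃ n R : 𝔐, r = pair n R ∧ IsVecSet n R}

variable (𝔐) in
/-- The equality relation `[x = y] ⊆ {0,1}²` (as a class with one element). -/
def eqRel : Set 𝔐 :=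
  {r | ∃ R : 𝔐, r = pair (1 + 1) R ∧ IsVecSet (1 + 1) R ∧
    ∀ v, IsVec (1 + 1) v → (Elem v R ↔ (Elem 0 v ↔ Elem 1 v))}

/-- A set of numbers is finite, in the sense of the structure, if it is bounded. -/
def IsFin (X : Set 𝔐) : Prop := ∃ b : 𝔐, ∀ x ∈ X, x < b

/-- A set of numbers is infinite, in the sense of the structure. -/
def IsInf (X : Set 𝔐) : Prop := ¬ IsFin X

/-! ### Boolean formulas and satisfaction -/

/-- `φ` is (the code of) an `S`-formula `R(y₀, …, yₙ₋₁)` with `R ∈ S` and all `yᵢ ∈ V`. -/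
def IsFormula (S V : Set 𝔐) (φ : 𝔐) : Prop :=
  ∃ n R s : 𝔐, φ = pair (pair n R) s ∧ pair n R ∈ S ∧ IsSeq n s ∧
    ∀ i y, Elem (pair i y) s → y ∈ V

/-- The assignment under which exactly the variables in `A` are true satisfies `φ`: for
`φ = R(y₀, …, yₙ₋₁)`, the vector of the truth values of the `yᵢ` lies in `R`. -/
def Sat (A : Set 𝔐) (φ : 𝔐) : Prop :=
  ∃ n R s v : 𝔐, φ = pair (pair n R) s ∧ Elem v R ∧
    ∀ i y, Elem (pair i y) s → (Elem i v ↔ y ∈ A)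

variable (𝔐) in
/-- `C` is finitely satisfiable. -/
def FinitelySatisfiable (C : Set 𝔐) : Prop :=
  ∀ F ∈ 𝔐.sets, F ⊆ C → IsFin F → ∃ A ∈ 𝔐.sets, ∀ φ ∈ F, Sat A φ

variable (𝔐) in
/-- `H` is homogeneous for `C`: for some truth value `c`, every finite subset of `C` is satisfied
by an assignment that is constantly `c` on `H`. -/
def Homogeneous (C H : Set 𝔐) : Prop :=
  ∃ c : Bool, ∀ F ∈ 𝔐.sets, F ⊆ C → IsFin F →
    ∃ A ∈ 𝔐.sets, (∀ φ ∈ F, Sat A φ) ∧ ∀ a ∈ H, (a ∈ A ↔ c = true)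

variable (𝔐) in
/-- The localized principle `LRSAT(S)`. -/
def LRSAT (S : Set 𝔐) : Prop :=
  ∀ V ∈ 𝔐.sets, IsInf V →
    ∀ C ∈ 𝔐.sets, (∀ φ ∈ C, IsFormula S V φ) → 𝔐.FinitelySatisfiable C →
      ∀ L ∈ 𝔐.sets, L ⊆ V → IsInf L →
        ∃ H ∈ 𝔐.sets, H ⊆ L ∧ IsInf H ∧ 𝔐.Homogeneous C H

variable (𝔐) in
/-- The principle `RSAT(S)`. -/
def RSAT (S : Set 𝔐) : Prop :=
  ∀ V ∈ 𝔐.sets, IsInf V →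
    ∀ C ∈ 𝔐.sets, (∀ φ ∈ C, IsFormula S V φ) → 𝔐.FinitelySatisfiable C →
      ∃ H ∈ 𝔐.sets, H ⊆ V ∧ IsInf H ∧ 𝔐.Homogeneous C H

/-! ### Co-clones -/

variable (𝔐) in
/-- The closure of `S` under existential quantification, equality and conjunction: the relations
`R ⊆ {0,1}ⁿ` defined by a formula `∃ y⃗, ⋀ F`, where `F` is a finite set of formulas
over `S` and equality, the free variables are the numbers below `n`, and all other variables are
quantified. -/
def coClone (S : Set 𝔐) : Set 𝔐 :=
  {r | ∃ n R : 𝔐, r = pair n R ∧ IsVecSet n R ∧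
    ∃ F ∈ 𝔐.sets, IsFin F ∧ (∀ φ ∈ F, IsFormula (S ∪ 𝔐.eqRel) Set.univ φ) ∧
      ∀ v, IsVec n v →
        (Elem v R ↔ ∃ A ∈ 𝔐.sets, (∀ i, i < n → (i ∈ A ↔ Elem i v)) ∧ ∀ φ ∈ F, Sat A φ)}

variable (𝔐) in
/-- `S` is a co-clone: a class of Boolean relations closed under existential quantification,
equality and conjunction. -/
def IsCoClone (S : Set 𝔐) : Prop := S ⊆ 𝔐.boolRels ∧ 𝔐.coClone S ⊆ S

/-! ### Affine and bijunctive relations -/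

variable (𝔐) in
/-- The number of `j < n` with `j ∈ X` is odd: `P` consists of those `j ≤ n` below which there
is an odd number of elements of `X`. -/
def IsOdd (n : 𝔐) (X : Set 𝔐) : Prop :=
  ∃ P ∈ 𝔐.sets, 0 ∉ P ∧ (∀ j, j < n → (j + 1 ∈ P ↔ ¬ (j ∈ P ↔ j ∈ X))) ∧ n ∈ P

variable (𝔐) in
/-- The affine relations: those defined by a finite set `E` of equations `⨁_{j ∈ D} xⱼ = i`, with
`D` a finite set of indices below `n` and `i ∈ {0, 1}`, coded as pairs `(D, i)`. -/
def affineRels : Set 𝔐 :=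
  {r | ∃ n R : 𝔐, r = pair n R ∧ IsVecSet n R ∧
    ∃ E ∈ 𝔐.sets, IsFin E ∧
      (∀ e ∈ E, ∃ D i : 𝔐, e = pair D i ∧ (∀ j, Elem j D → j < n) ∧ (i = 0 ∨ i = 1)) ∧
      ∀ v, IsVec n v →
        (Elem v R ↔
          ∀ D i : 𝔐, pair D i ∈ E → (𝔐.IsOdd n {j | Elem j D ∧ Elem j v} ↔ i = 1))}

variable (𝔐) in
/-- The bijunctive relations: those defined by a finite set `E` of clauses with at most two
literals. The literals `xⱼ` and `¬ xⱼ`, `j < n`, are coded as `(j, 1)` and `(j, 0)`, and a clause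
as the finite set of its literals. -/
def bijunctiveRels : Set 𝔐 :=
  {r | ∃ n R : 𝔐, r = pair n R ∧ IsVecSet n R ∧
    ∃ E ∈ 𝔐.sets, IsFin E ∧
      (∀ κ ∈ E, (∀ l, Elem l κ → ∃ j : 𝔐, j < n ∧ (l = pair j 0 ∨ l = pair j 1)) ∧
        ∃ l₁ l₂ : 𝔐, ∀ l, Elem l κ → l = l₁ ∨ l = l₂) ∧
      ∀ v, IsVec n v →
        (Elem v R ↔
          ∀ κ ∈ E, ∃ j : 𝔐, (Elem (pair j 1) κ ∧ Elem j v) ∨ (Elem (pair j 0) κ ∧ ¬ Elem j v))}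

end L2Structure

/-- `RCA₀` entails `P`, that is, `P` holds in every model of `RCA₀`. Provability in first-order
logic is entailment in this sense, by Gödel's completeness theorem. A statement `P` about a
class of numbers defined by an arbitrary formula (with parameters) is a scheme, of which all
instances are entailed. -/
def RCA₀Proves (P : L2Structure.{u} → Prop) : Prop :=
  ∀ 𝔐 : L2Structure.{u}, 𝔐.ModelsRCA₀ → P 𝔐

open Function

/-! ### Definability -/

namespace L2Term

/-- Renaming of the variables of a term. -/
def rename (f : ℕ → ℕ) : L2Term → L2Term
  | .var x => .var (f x)
  | .zero => .zero
  | .one => .one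
  | .add s t => .add (rename f s) (rename f t)
  | .mul s t => .mul (rename f s) (rename f t)

end L2Term

namespace L2BddFormula

/-- Renaming of the number variables and the set variables of a formula. -/
def rename (f g : ℕ → ℕ) : L2BddFormula → L2BddFormula
  | .eq s t => .eq (s.rename f) (t.rename f)
  | .lt s t => .lt (s.rename f) (t.rename f)
  | .mem t X => .mem (t.rename f) (g X)
  | .neg φ => .neg (rename f g φ)
  | .and φ ψ => .and (rename f g φ) (rename f g ψ)
  | .ball x t φ => .ball (f x) (t.rename f) (rename f g φ)

end L2BddFormula

namespace L2Structure

variable {𝔐 : L2Structure.{u}}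

theorem termVal_rename (f : ℕ → ℕ) (v : ℕ → 𝔐) (t : L2Term) :
    𝔐.termVal v (t.rename f) = 𝔐.termVal (v ∘ f) t := by
  induction t <;> simp_all [L2Term.rename, termVal]

theorem realize_rename {f : ℕ → ℕ} (hf : Injective f) (g : ℕ → ℕ) (V : ℕ → Set 𝔐)
    (φ : L2BddFormula) (v : ℕ → 𝔐) :
    𝔐.Realize V (φ.rename f g) v ↔ 𝔐.Realize (V ∘ g) φ (v ∘ f) := by
  induction φ generalizing v with
  | eq s t => simp [L2BddFormula.rename, Realize, termVal_rename]
  | lt s t => simp [L2BddFormula.rename, Realize, termVal_rename]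
  | mem t X => simp [L2BddFormula.rename, Realize, termVal_rename]
  | neg φ ih => simp [L2BddFormula.rename, Realize, ih]
  | and φ ψ ih ih' => simp [L2BddFormula.rename, Realize, ih, ih']
  | ball x t φ ih =>
    simp [L2BddFormula.rename, Realize, ih, termVal_rename, update_comp_eq_of_injective _ hf]

/-- The set belongs to the second-order part of the structure. -/
class IsSet (X : Set 𝔐) : Prop where
  mem_sets : X ∈ 𝔐.sets

/-- Functions given by a term with number parameters. -/
class inductive IsTerm {n : ℕ} : ((Fin n → 𝔐) → 𝔐) → Prop
  | var (i : Fin n) : IsTerm fun v => v i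
  | const (c : 𝔐) : IsTerm fun _ => c
  | add {s t : (Fin n → 𝔐) → 𝔐} (hs : IsTerm s) (ht : IsTerm t) : IsTerm fun v => s v + t v
  | mul {s t : (Fin n → 𝔐) → 𝔐} (hs : IsTerm s) (ht : IsTerm t) : IsTerm fun v => s v * t v

/-- Relations given by a bounded-quantifier formula with parameters. -/
class inductive IsBdd : ∀ {n : ℕ}, ((Fin n → 𝔐) → Prop) → Prop
  | eq {n : ℕ} {s t : (Fin n → 𝔐) → 𝔐} (hs : IsTerm s) (ht : IsTerm t) : IsBdd fun v => s v = t v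
  | lt {n : ℕ} {s t : (Fin n → 𝔐) → 𝔐} (hs : IsTerm s) (ht : IsTerm t) : IsBdd fun v => s v < t v
  | mem {n : ℕ} {t : (Fin n → 𝔐) → 𝔐} {X : Set 𝔐} (hX : IsSet X) (ht : IsTerm t) :
      IsBdd fun v => t v ∈ X
  | not {n : ℕ} {P : (Fin n → 𝔐) → Prop} (hP : IsBdd P) : IsBdd fun v => ¬ P v
  | and {n : ℕ} {P Q : (Fin n → 𝔐) → Prop} (hP : IsBdd P) (hQ : IsBdd Q) :
      IsBdd fun v => P v ∧ Q v
  | snoc_ball {n : ℕ} {t : (Fin n → 𝔐) → 𝔐} {P : (Fin (n + 1) → 𝔐) → Prop} (ht : IsTerm t)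
      (hP : IsBdd P) : IsBdd fun v => ∀ a, a < t v → P (Fin.snoc v a)

attribute [instance] IsTerm.var IsTerm.const

section instances

variable {n : ℕ} {s t : (Fin n → 𝔐) → 𝔐} {P Q : (Fin n → 𝔐) → Prop}

instance [hs : IsTerm s] [ht : IsTerm t] : IsTerm fun v => s v + t v := .add hs ht

instance [hs : IsTerm s] [ht : IsTerm t] : IsTerm fun v => s v * t v := .mul hs ht

instance [hs : IsTerm s] [ht : IsTerm t] : IsBdd fun v => s v = t v := .eq hs ht

instance [hs : IsTerm s] [ht : IsTerm t] : IsBdd fun v => s v < t v := .lt hs ht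

instance {X : Set 𝔐} [hX : IsSet X] [ht : IsTerm t] : IsBdd fun v => t v ∈ X := .mem hX ht

instance [hP : IsBdd P] : IsBdd fun v => ¬ P v := .not hP

instance [hP : IsBdd P] [hQ : IsBdd Q] : IsBdd fun v => P v ∧ Q v := .and hP hQ

end instances

/-- The assignment of number variables that gives the even variables the values in `v` and the
odd variables the values in `w`. -/
def interleave {n : ℕ} (v : Fin n → 𝔐) (w : ℕ → 𝔐) (i : ℕ) : 𝔐 :=
  if i % 2 = 0 then (if h : i / 2 < n then v ⟨i / 2, h⟩ else 0) else w (i / 2)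

theorem update_interleave {n : ℕ} (v : Fin n → 𝔐) (w : ℕ → 𝔐) (a : 𝔐) :
    update (interleave v w) (2 * n) a = interleave (Fin.snoc v a : Fin (n + 1) → 𝔐) w := by
  ext i
  rcases eq_or_ne i (2 * n) with rfl | h
  · simp [interleave, Fin.snoc]
  · rw [update_of_ne h]
    unfold interleave
    split_ifs with h1 h2 h3 h3
    · simp [Fin.snoc, h2]
    · omega
    · omega
    · rfl
    · rfl

/-- The even members of the merged sequence are those of `a`, the odd ones those of `b`. -/
def merge {α : Type*} (a b : ℕ → α) (i : ℕ) : α := if i % 2 = 0 then a (i / 2) else b (i / 2)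

/-- Variable renaming that moves the parameters to the even places of a merged sequence. -/
def mvLeft (i : ℕ) : ℕ := if i % 2 = 0 then i else 2 * i - 1

/-- Variable renaming that moves the parameters to the odd places of a merged sequence. -/
def mvRight (i : ℕ) : ℕ := if i % 2 = 0 then i else 2 * i + 1

theorem mvLeft_injective : Injective mvLeft := by
  intro i j h; unfold mvLeft at h; split_ifs at h <;> omega

theorem mvRight_injective : Injective mvRight := by
  intro i j h; unfold mvRight at h; split_ifs at h <;> omega

theorem interleave_comp_mvLeft {n : ℕ} (v : Fin n → 𝔐) (w w' : ℕ → 𝔐) :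
    interleave v (merge w w') ∘ mvLeft = interleave v w := by
  ext i
  by_cases h : i % 2 = 0
  · simp [interleave, mvLeft, h]
  · have h1 : (2 * i - 1) % 2 = 1 := by omega
    have h2 : (2 * i - 1) / 2 % 2 = 0 := by omega
    have h3 : (2 * i - 1) / 2 / 2 = i / 2 := by omega
    simp [interleave, mvLeft, merge, h, h1, h2, h3]

theorem interleave_comp_mvRight {n : ℕ} (v : Fin n → 𝔐) (w w' : ℕ → 𝔐) :
    interleave v (merge w w') ∘ mvRight = interleave v w' := by
  ext i
  by_cases h : i % 2 = 0
  · simp [interleave, mvRight, h]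
  · have h1 : (2 * i + 1) % 2 = 1 := by omega
    have h2 : (2 * i + 1) / 2 % 2 = 1 := by omega
    have h3 : (2 * i + 1) / 2 / 2 = i / 2 := by omega
    simp [interleave, mvRight, merge, h, h1, h2, h3]

theorem merge_comp_left {α : Type*} (a b : ℕ → α) : (merge a b ∘ fun i => 2 * i) = a := by
  ext i; simp [merge]

theorem merge_comp_right {α : Type*} (a b : ℕ → α) : (merge a b ∘ fun i => 2 * i + 1) = b := by
  ext i
  have h1 : (2 * i + 1) % 2 = 1 := by omega
  have h2 : (2 * i + 1) / 2 = i := by omega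
  simp [merge, h1, h2]

theorem IsTerm.exists_term {n : ℕ} {t : (Fin n → 𝔐) → 𝔐} (ht : IsTerm t) :
    ∃ (s : L2Term) (w : ℕ → 𝔐), ∀ v, t v = 𝔐.termVal (interleave v w) s := by
  induction ht with
  | var i => exact ⟨.var (2 * i), fun _ => 0, fun v => by simp [termVal, interleave]⟩
  | const c => exact ⟨.var 1, fun _ => c, fun v => by simp [termVal, interleave]⟩
  | add _ _ ih ih' =>
    obtain ⟨s, w, h⟩ := ih
    obtain ⟨s', w', h'⟩ := ih'
    refine ⟨.add (s.rename mvLeft) (s'.rename mvRight), merge w w', fun v => ?_⟩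
    simp only [termVal, termVal_rename, interleave_comp_mvLeft, interleave_comp_mvRight, h, h']
  | mul _ _ ih ih' =>
    obtain ⟨s, w, h⟩ := ih
    obtain ⟨s', w', h'⟩ := ih'
    refine ⟨.mul (s.rename mvLeft) (s'.rename mvRight), merge w w', fun v => ?_⟩
    simp only [termVal, termVal_rename, interleave_comp_mvLeft, interleave_comp_mvRight, h, h']

theorem IsBdd.exists_formula {n : ℕ} {P : (Fin n → 𝔐) → Prop} (hP : IsBdd P) :
    ∃ (φ : L2BddFormula) (w : ℕ → 𝔐) (V : ℕ → Set 𝔐), (∀ i, V i ∈ 𝔐.sets) ∧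
      ∀ v, P v ↔ 𝔐.Realize V φ (interleave v w) := by
  obtain ⟨X₀, hX₀⟩ := 𝔐.sets_nonempty
  induction hP with
  | @eq _ _ _ hs ht =>
    obtain ⟨s, w, h⟩ := hs.exists_term
    obtain ⟨s', w', h'⟩ := ht.exists_term
    refine ⟨.eq (s.rename mvLeft) (s'.rename mvRight), merge w w', fun _ => X₀, fun _ => hX₀,
      fun v => ?_⟩
    simp only [Realize, termVal_rename, interleave_comp_mvLeft, interleave_comp_mvRight, h, h']
  | @lt _ _ _ hs ht =>
    obtain ⟨s, w, h⟩ := hs.exists_term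
    obtain ⟨s', w', h'⟩ := ht.exists_term
    refine ⟨.lt (s.rename mvLeft) (s'.rename mvRight), merge w w', fun _ => X₀, fun _ => hX₀,
      fun v => ?_⟩
    simp only [Realize, termVal_rename, interleave_comp_mvLeft, interleave_comp_mvRight, h, h']
  | @mem _ _ X hX ht =>
    obtain ⟨s, w, h⟩ := ht.exists_term
    exact ⟨.mem s 0, w, fun _ => X, fun _ => hX.mem_sets, fun v => by simp only [Realize, h]⟩
  | not _ ih =>
    obtain ⟨φ, w, V, hV, h⟩ := ih
    exact ⟨.neg φ, w, V, hV, fun v => by simp only [Realize, h]⟩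
  | and _ _ ih ih' =>
    obtain ⟨φ, w, V, hV, h⟩ := ih
    obtain ⟨φ', w', V', hV', h'⟩ := ih'
    refine ⟨.and (φ.rename mvLeft fun i => 2 * i) (φ'.rename mvRight fun i => 2 * i + 1),
      merge w w', merge V V', fun i => ?_, fun v => ?_⟩
    · unfold merge; split_ifs <;> simp [hV, hV']
    · simp only [Realize, realize_rename mvLeft_injective, realize_rename mvRight_injective,
        interleave_comp_mvLeft, interleave_comp_mvRight, merge_comp_left, merge_comp_right, h, h']
  | @snoc_ball n t P ht _ ih =>
    obtain ⟨s, w, h⟩ := ht.exists_term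
    obtain ⟨φ, w', V, hV, h'⟩ := ih
    refine ⟨.ball (2 * n) (s.rename mvLeft) (φ.rename mvRight id), merge w w', V, hV,
      fun v => ?_⟩
    simp only [Realize, termVal_rename, realize_rename mvRight_injective, update_interleave,
      interleave_comp_mvLeft, interleave_comp_mvRight, h, h', comp_id]

instance IsBdd.ball {n : ℕ} {t : (Fin n → 𝔐) → 𝔐} {P : (Fin n → 𝔐) → 𝔐 → Prop} [ht : IsTerm t]
    [hP : IsBdd fun v : Fin (n + 1) → 𝔐 => P (fun i => v i.castSucc) (v (Fin.last n))] :
    IsBdd fun v => ∀ a, a < t v → P v a := by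
  simpa using IsBdd.snoc_ball (ht := ht) (hP := hP)

theorem IsBdd.congr {n : ℕ} {P Q : (Fin n → 𝔐) → Prop} (hP : IsBdd P) (h : ∀ v, Q v ↔ P v) :
    IsBdd Q := by
  rwa [show Q = P from funext fun v => propext (h v)]

instance IsBdd.bex {n : ℕ} {t : (Fin n → 𝔐) → 𝔐} {P : (Fin n → 𝔐) → 𝔐 → Prop} [ht : IsTerm t]
    [hP : IsBdd fun v : Fin (n + 1) → 𝔐 => P (fun i => v i.castSucc) (v (Fin.last n))] :
    IsBdd fun v => ∃ a, a < t v ∧ P v a :=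
  IsBdd.congr (P := fun v => ¬ ∀ a, a < t v → ¬ P v a) inferInstance fun v => by simp

instance IsBdd.or {n : ℕ} {P Q : (Fin n → 𝔐) → Prop} [IsBdd P] [IsBdd Q] :
    IsBdd fun v => P v ∨ Q v :=
  IsBdd.congr (P := fun v => ¬ (¬ P v ∧ ¬ Q v)) inferInstance fun v => by tauto

instance IsBdd.imp {n : ℕ} {P Q : (Fin n → 𝔐) → Prop} [IsBdd P] [IsBdd Q] :
    IsBdd fun v => P v → Q v :=
  IsBdd.congr (P := fun v => ¬ (P v ∧ ¬ Q v)) inferInstance fun v => by tauto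

theorem IsTerm.subst {n m : ℕ} {t : (Fin n → 𝔐) → 𝔐} (ht : IsTerm t)
    {τ : Fin n → (Fin m → 𝔐) → 𝔐} (hτ : ∀ i, IsTerm (τ i)) : IsTerm fun v => t fun i => τ i v := by
  induction ht with
  | var i => exact hτ i
  | const c => exact .const _
  | add _ _ ih ih' => exact .add ih ih'
  | mul _ _ ih ih' => exact .mul ih ih'

theorem IsBdd.subst {n : ℕ} {P : (Fin n → 𝔐) → Prop} (hP : IsBdd P) {m : ℕ}
    {τ : Fin n → (Fin m → 𝔐) → 𝔐} (hτ : ∀ i, IsTerm (τ i)) : IsBdd fun v => P fun i => τ i v := by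
  induction hP generalizing m with
  | eq hs ht => exact .eq (hs.subst hτ) (ht.subst hτ)
  | lt hs ht => exact .lt (hs.subst hτ) (ht.subst hτ)
  | mem hX ht => exact .mem hX (ht.subst hτ)
  | not _ ih => exact .not (ih hτ)
  | and _ _ ih ih' => exact .and (ih hτ) (ih' hτ)
  | @snoc_ball n t P ht _ ih =>
    let τ' : Fin (n + 1) → (Fin (m + 1) → 𝔐) → 𝔐 :=
      Fin.snoc (α := fun _ => (Fin (m + 1) → 𝔐) → 𝔐)
        (fun i v => τ i fun j => v j.castSucc) fun v => v (Fin.last m)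
    have hτ' : ∀ i, IsTerm (τ' i) := by
      refine Fin.lastCases ?_ fun i => ?_
      · simpa [τ'] using IsTerm.var _
      · simpa [τ'] using (hτ i).subst fun j => IsTerm.var j.castSucc
    refine (IsBdd.snoc_ball (ht.subst hτ) (ih hτ')).congr fun v => forall₂_congr fun a _ => ?_
    suffices (Fin.snoc (fun i => τ i v) a : Fin (n + 1) → 𝔐) = fun i => τ' i (Fin.snoc v a) by
      rw [this]
    ext i
    refine Fin.lastCases ?_ (fun i => ?_) i <;> simp [τ']

theorem IsBdd.reindex {n : ℕ} {P : (Fin n → 𝔐) → Prop} (hP : IsBdd P) {m : ℕ}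
    (σ : Fin n → Fin m) : IsBdd fun v : Fin m → 𝔐 => P fun i => v (σ i) :=
  hP.subst fun i => .var (σ i)

theorem IsBdd.isSigma01 {Q : (Fin 2 → 𝔐) → Prop} (hQ : IsBdd Q) {P : 𝔐 → Prop}
    (h : ∀ a, P a ↔ ∃ m, Q ![a, m]) : 𝔐.IsSigma01 {a | P a} := by
  obtain ⟨φ, w, V, hV, hφ⟩ := hQ.exists_formula
  let f : ℕ → ℕ := fun i => if i = 0 then 0 else if i = 2 then 1 else i + 2
  have hf : Injective f := by
    intro i j hij
    simp only [f] at hij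
    split_ifs at hij <;> omega
  refine ⟨φ.rename f id, fun i => interleave (![0, 0] : Fin 2 → 𝔐) w (i - 2), V, hV, fun a => ?_⟩
  simp only [Set.mem_ofPred_eq, h, hφ, realize_rename hf, comp_id]
  refine exists_congr fun m => ?_
  refine iff_of_eq (congrArg _ (funext fun i => ?_))
  simp only [comp_apply, f]
  split_ifs with h0 h2
  · subst h0; simp [interleave]
  · subst h2; simp [interleave]
  · rw [update_of_ne (by omega), update_of_ne (by omega), Nat.add_sub_cancel]
    unfold interleave
    split_ifs with h3 h4
    · omega
    · rfl
    · rfl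

end L2Structure

/-! ### Arithmetic in models of `RCA₀` -/

namespace L2Structure

variable {𝔐 : L2Structure.{u}}

/-- The structure is a model of `RCA₀`. -/
class IsModel (𝔐 : L2Structure.{u}) : Prop where
  models : 𝔐.ModelsRCA₀

section algebra

variable [h𝔐 : IsModel 𝔐]

theorem exists_induction {Q : 𝔐 → 𝔐 → Prop} [hQ : IsBdd fun v : Fin 2 → 𝔐 => Q (v 0) (v 1)]
    (h0 : ∃ m, Q 0 m) (h1 : ∀ n, (∃ m, Q n m) → ∃ m, Q (n + 1) m) (n : 𝔐) : ∃ m, Q n m :=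
  h𝔐.models.sigma01_induction {n | ∃ m, Q n m} (hQ.isSigma01 fun a => by simp) h0 h1 n

theorem bdd_induction {P : 𝔐 → Prop} [hP : IsBdd fun v : Fin 1 → 𝔐 => P (v 0)]
    (h0 : P 0) (h1 : ∀ n, P n → P (n + 1)) (n : 𝔐) : P n := by
  have : IsBdd fun v : Fin 2 → 𝔐 => P (v 0) := hP.reindex fun _ => 0
  simpa using exists_induction (Q := fun a _ => P a) (by simpa using h0) (by simpa using h1) n

theorem add_zero' (a : 𝔐) : a + 0 = a := h𝔐.models.add_zero a

theorem add_succ' (a b : 𝔐) : a + (b + 1) = a + b + 1 := h𝔐.models.add_succ a b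

theorem mul_zero' (a : 𝔐) : a * 0 = 0 := h𝔐.models.mul_zero a

theorem mul_succ' (a b : 𝔐) : a * (b + 1) = a * b + a := h𝔐.models.mul_succ a b

theorem zero_add' (a : 𝔐) : 0 + a = a :=
  bdd_induction (P := fun a => 0 + a = a) (add_zero' 0) (fun n h => by rw [add_succ', h]) a

theorem add_assoc' (a b c : 𝔐) : a + b + c = a + (b + c) :=
  bdd_induction (P := fun c => a + b + c = a + (b + c)) (by simp only [add_zero'])
    (fun n h => by simp only [add_succ', h]) c

theorem succ_add' (a b : 𝔐) : a + 1 + b = a + b + 1 :=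
  bdd_induction (P := fun b => a + 1 + b = a + b + 1) (by simp only [add_zero'])
    (fun n h => by simp only [add_succ', h]) b

theorem add_comm' (a b : 𝔐) : a + b = b + a :=
  bdd_induction (P := fun b => a + b = b + a) (by simp only [add_zero', zero_add'])
    (fun n h => by simp only [add_succ', succ_add', h]) b

theorem zero_mul' (a : 𝔐) : 0 * a = 0 :=
  bdd_induction (P := fun a => 0 * a = 0) (mul_zero' 0)
    (fun n h => by rw [mul_succ', h, add_zero']) a

theorem succ_mul' (a b : 𝔐) : (a + 1) * b = a * b + b :=
  bdd_induction (P := fun b => (a + 1) * b = a * b + b) (by simp only [mul_zero', add_zero'])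
    (fun n h => by
      rw [mul_succ', mul_succ', h, add_assoc', add_assoc', ← add_assoc' n, ← add_assoc' a,
        add_comm' n a]) b

theorem mul_comm' (a b : 𝔐) : a * b = b * a :=
  bdd_induction (P := fun b => a * b = b * a) (by simp only [mul_zero', zero_mul'])
    (fun n h => by rw [mul_succ', succ_mul', h]) b

theorem mul_add' (a b c : 𝔐) : a * (b + c) = a * b + a * c :=
  bdd_induction (P := fun c => a * (b + c) = a * b + a * c) (by simp only [mul_zero', add_zero'])
    (fun n h => by rw [add_succ', mul_succ', mul_succ', h, add_assoc']) c

theorem mul_assoc' (a b c : 𝔐) : a * b * c = a * (b * c) :=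
  bdd_induction (P := fun c => a * b * c = a * (b * c)) (by simp only [mul_zero'])
    (fun n h => by rw [mul_succ', mul_succ', mul_add', h]) c

theorem mul_one' (a : 𝔐) : a * 1 = a := by
  rw [← zero_add' (1 : 𝔐), mul_succ', mul_zero', zero_add']

instance : CommSemiring 𝔐 where
  add_assoc := add_assoc'
  zero_add := zero_add'
  add_zero := add_zero'
  add_comm := add_comm'
  nsmul := nsmulRec
  left_distrib := mul_add'
  right_distrib a b c := by rw [mul_comm', mul_add', mul_comm' c, mul_comm' c]
  zero_mul := zero_mul'
  mul_zero := mul_zero'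
  mul_assoc := mul_assoc'
  one_mul a := by rw [mul_comm', mul_one']
  mul_one := mul_one'
  mul_comm := mul_comm'

theorem add_cancel' {a b c : 𝔐} : a + c = b + c → a = b :=
  bdd_induction (P := fun c => a + c = b + c → a = b) (by simp)
    (fun n h h' => h (h𝔐.models.succ_inj _ _ (by simpa only [add_succ'] using h'))) c

theorem lt_succ' {a b : 𝔐} : a < b + 1 ↔ a < b ∨ a = b := h𝔐.models.lt_succ_iff a b

theorem not_lt_zero' (a : 𝔐) : ¬ a < 0 := h𝔐.models.not_lt_zero a

theorem lt_iff_exists' {a b : 𝔐} : a < b ↔ ∃ c, b = a + (c + 1) := by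
  constructor
  · have := exists_induction (Q := fun b c => a < b → b = a + (c + 1))
      ⟨0, fun h => (not_lt_zero' _ h).elim⟩ (fun n ⟨c, hc⟩ => ?_) b
    · obtain ⟨c, hc⟩ := this
      exact fun h => ⟨c, hc h⟩
    · by_cases h : a < n
      · refine ⟨c + 1, fun _ => ?_⟩
        rw [hc h]; simp only [add_assoc]
      · refine ⟨0, fun h' => ?_⟩
        rw [(lt_succ'.1 h').resolve_left h, zero_add]
  · rintro ⟨c, rfl⟩
    exact bdd_induction (P := fun c => a < a + (c + 1))
      (by rw [zero_add]; exact lt_succ'.2 (.inr rfl))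
      (fun n h => by rw [add_succ']; exact lt_succ'.2 (.inl h)) c

theorem eq_zero_or_succ' (a : 𝔐) : a = 0 ∨ ∃ b, a = b + 1 := by
  have := exists_induction (Q := fun a b => a = 0 ∨ a = b + 1) ⟨0, .inl rfl⟩
    (fun n _ => ⟨n, .inr rfl⟩) a
  obtain ⟨b, h | h⟩ := this
  exacts [.inl h, .inr ⟨b, h⟩]

theorem lt_irrefl' (a : 𝔐) : ¬ a < a := fun h => by
  obtain ⟨c, hc⟩ := lt_iff_exists'.1 h
  have : c + 1 = 0 := by
    apply add_cancel' (c := a)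
    rw [zero_add, add_comm, ← hc]
  exact h𝔐.models.succ_ne_zero _ this

theorem lt_trans' {a b c : 𝔐} (h : a < b) (h' : b < c) : a < c := by
  obtain ⟨x, rfl⟩ := lt_iff_exists'.1 h
  obtain ⟨y, rfl⟩ := lt_iff_exists'.1 h'
  exact lt_iff_exists'.2 ⟨x + 1 + y, by simp only [add_assoc]⟩

theorem lt_trichotomy' (a b : 𝔐) : a < b ∨ a = b ∨ b < a := by
  refine bdd_induction (P := fun b => a < b ∨ a = b ∨ b < a) ?_ (fun b h => ?_) b
  · rcases eq_zero_or_succ' a with h | ⟨c, rfl⟩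
    · exact .inr (.inl h)
    · exact .inr (.inr (lt_iff_exists'.2 ⟨c, (zero_add _).symm⟩))
  · rcases h with h | h | h
    · exact .inl (lt_succ'.2 (.inl h))
    · exact .inl (lt_succ'.2 (.inr h))
    · obtain ⟨c, rfl⟩ := lt_iff_exists'.1 h
      rcases eq_zero_or_succ' c with rfl | ⟨d, rfl⟩
      · simp
      · exact .inr (.inr (lt_iff_exists'.2 ⟨d, by ring⟩))

noncomputable instance : LinearOrder 𝔐 where
  le a b := a < b ∨ a = b
  le_refl a := .inr rfl
  le_trans a b c h h' := by
    rcases h with h | rfl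
    · rcases h' with h' | rfl
      exacts [.inl (lt_trans' h h'), .inl h]
    · exact h'
  lt_iff_le_not_ge a b := by
    constructor
    · refine fun h => ⟨.inl h, ?_⟩
      rintro (h' | rfl)
      exacts [lt_irrefl' _ (lt_trans' h h'), lt_irrefl' _ h]
    · rintro ⟨h | rfl, h'⟩
      exacts [h, (h' (.inr rfl)).elim]
  le_antisymm a b h h' := by
    rcases h with h | rfl
    · rcases h' with h' | rfl
      exacts [(lt_irrefl' _ (lt_trans' h h')).elim, rfl]
    · rfl
  le_total a b := by rcases lt_trichotomy' a b with h | h | h <;> simp [h]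
  toDecidableLE := Classical.decRel _

theorem lt_add_one_iff {a b : 𝔐} : a < b + 1 ↔ a ≤ b := lt_succ'

theorem le_iff_exists' {a b : 𝔐} : a ≤ b ↔ ∃ c, b = a + c := by
  rw [le_iff_lt_or_eq]
  constructor
  · rintro (h | rfl)
    · obtain ⟨c, hc⟩ := lt_iff_exists'.1 h
      exact ⟨_, hc⟩
    · exact ⟨0, (add_zero _).symm⟩
  · rintro ⟨c, rfl⟩
    rcases eq_zero_or_succ' c with rfl | ⟨d, rfl⟩
    exacts [.inr (add_zero _).symm, .inl (lt_iff_exists'.2 ⟨d, rfl⟩)]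

instance : IsStrictOrderedRing 𝔐 where
  add_le_add_left a b h c := by
    obtain ⟨d, rfl⟩ := le_iff_exists'.1 h
    exact le_iff_exists'.2 ⟨d, by ring⟩
  le_of_add_le_add_left a b c h := by
    obtain ⟨d, hd⟩ := le_iff_exists'.1 h
    exact le_iff_exists'.2 ⟨d, add_cancel' (c := a) (by rw [add_comm c, hd]; ring)⟩
  zero_le_one := le_iff_exists'.2 ⟨1, (zero_add _).symm⟩
  exists_pair_ne := ⟨0, 1, fun h => h𝔐.models.succ_ne_zero 0 (by rw [zero_add, h])⟩
  mul_lt_mul_of_pos_left _ h b c hbc := by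
    obtain ⟨x, rfl⟩ := lt_iff_exists'.1 h
    obtain ⟨y, rfl⟩ := lt_iff_exists'.1 hbc
    exact lt_iff_exists'.2 ⟨x * y + x + y, by ring⟩
  mul_lt_mul_of_pos_right _ h b c hbc := by
    obtain ⟨x, rfl⟩ := lt_iff_exists'.1 h
    obtain ⟨y, rfl⟩ := lt_iff_exists'.1 hbc
    exact lt_iff_exists'.2 ⟨x * y + x + y, by ring⟩

instance : CanonicallyOrderedAdd 𝔐 where
  exists_add_of_le h := le_iff_exists'.1 h
  le_self_add _ b := le_iff_exists'.2 ⟨b, rfl⟩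
  le_add_self _ b := le_iff_exists'.2 ⟨b, add_comm _ _⟩

theorem succ_le_iff' {a b : 𝔐} : a + 1 ≤ b ↔ a < b := by
  rw [← not_lt, lt_add_one_iff, not_le]

end algebra

end L2Structure

/-! ### Recursive and recursively enumerable relations -/

namespace L2Structure

variable {𝔐 : L2Structure.{u}}

/-- The `Σ⁰₁` relations, with parameters. -/
class Sig {n : ℕ} (P : (Fin n → 𝔐) → Prop) : Prop where
  exists_bdd : ∃ Q : (Fin n → 𝔐) → 𝔐 → Prop,
    (IsBdd fun v : Fin (n + 1) → 𝔐 => Q (fun i => v i.castSucc) (v (Fin.last n))) ∧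
      ∀ v, P v ↔ ∃ m, Q v m

/-- The `Δ⁰₁` relations, with parameters. -/
class Rec {n : ℕ} (P : (Fin n → 𝔐) → Prop) : Prop where
  pos : Sig P
  neg : Sig fun v => ¬ P v

/-- The functions with `Δ⁰₁` graph. -/
class RecFun {n : ℕ} (f : (Fin n → 𝔐) → 𝔐) : Prop where
  graph : Sig fun v : Fin (n + 1) → 𝔐 => v (Fin.last n) = f fun i => v i.castSucc

instance Rec.sig {n : ℕ} {P : (Fin n → 𝔐) → Prop} [h : Rec P] : Sig P := h.pos

theorem Sig.congr {n : ℕ} {P Q : (Fin n → 𝔐) → Prop} (hP : Sig P) (h : ∀ v, Q v ↔ P v) :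
    Sig Q := by
  rwa [show Q = P from funext fun v => propext (h v)]

theorem Rec.congr {n : ℕ} {P Q : (Fin n → 𝔐) → Prop} (hP : Rec P) (h : ∀ v, Q v ↔ P v) :
    Rec Q := by
  rwa [show Q = P from funext fun v => propext (h v)]

theorem IsBdd.sig {n : ℕ} {P : (Fin n → 𝔐) → Prop} (hP : IsBdd P) : Sig P :=
  ⟨fun v _ => P v, hP.reindex Fin.castSucc, by simp⟩

theorem IsBdd.isRec {n : ℕ} {P : (Fin n → 𝔐) → Prop} (hP : IsBdd P) : Rec P :=
  ⟨hP.sig, hP.not.sig⟩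

instance Rec.not {n : ℕ} {P : (Fin n → 𝔐) → Prop} [h : Rec P] : Rec fun v => ¬ P v :=
  ⟨h.neg, h.pos.congr fun _ => not_not⟩

instance Rec.const {n : ℕ} {p : Prop} : Rec fun _ : Fin n → 𝔐 => p := by
  refine IsBdd.isRec ?_
  by_cases h : p
  · exact IsBdd.congr (P := fun _ => (0 : 𝔐) = 0) inferInstance (by simp [h])
  · exact IsBdd.congr (P := fun _ => ¬ (0 : 𝔐) = 0) inferInstance (by simp [h])

theorem Sig.reindex {n : ℕ} {P : (Fin n → 𝔐) → Prop} (hP : Sig P) {m : ℕ}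
    (σ : Fin n → Fin m) : Sig fun v : Fin m → 𝔐 => P fun i => v (σ i) := by
  obtain ⟨Q, hQ, h⟩ := hP
  refine ⟨fun v m => Q (fun i => v (σ i)) m, ?_, fun v => h _⟩
  have := hQ.reindex (Fin.snoc (α := fun _ => Fin (m + 1)) (fun i => (σ i).castSucc) (Fin.last m))
  simpa using this

theorem Rec.reindex {n : ℕ} {P : (Fin n → 𝔐) → Prop} (hP : Rec P) {m : ℕ}
    (σ : Fin n → Fin m) : Rec fun v : Fin m → 𝔐 => P fun i => v (σ i) :=
  ⟨hP.pos.reindex σ, hP.neg.reindex σ⟩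

theorem IsBdd.reindex₂ {n k : ℕ} {R : (Fin n → 𝔐) → 𝔐 → Prop} (hP : IsBdd fun v : Fin (n + 1) → 𝔐 =>
    R (fun i => v i.castSucc) (v (Fin.last n))) (σ : Fin n → Fin k) (j : Fin k) :
    IsBdd fun v : Fin k → 𝔐 => R (fun i => v (σ i)) (v j) := by
  simpa using hP.reindex (Fin.snoc (α := fun _ => Fin k) σ j)

theorem Sig.reindex₂ {n k : ℕ} {R : (Fin n → 𝔐) → 𝔐 → Prop} (hP : Sig fun v : Fin (n + 1) → 𝔐 =>
    R (fun i => v i.castSucc) (v (Fin.last n))) (σ : Fin n → Fin k) (j : Fin k) :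
    Sig fun v : Fin k → 𝔐 => R (fun i => v (σ i)) (v j) := by
  simpa using hP.reindex (Fin.snoc (α := fun _ => Fin k) σ j)

section closure

variable [IsModel 𝔐]

theorem exists_induction_sig {P : 𝔐 → Prop} [hP : Sig fun v : Fin 1 → 𝔐 => P (v 0)]
    (h0 : P 0) (h1 : ∀ n, P n → P (n + 1)) (n : 𝔐) : P n := by
  obtain ⟨Q, hQ, h⟩ := hP
  have hP : ∀ n, P n ↔ ∃ m, Q (fun _ => n) m := fun n => h fun _ => n
  simp only [hP] at h0 h1 ⊢
  have : IsBdd fun v : Fin 2 → 𝔐 => Q (fun _ => v 0) (v 1) := by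
    refine hQ.congr fun v => iff_of_eq (congrArg (fun w => Q w _) (funext fun i => ?_))
    rw [Subsingleton.elim i 0]; rfl
  exact exists_induction (Q := fun n m => Q (fun _ => n) m) h0 h1 n

variable {n : ℕ} {P Q : (Fin n → 𝔐) → Prop} {R : (Fin n → 𝔐) → 𝔐 → Prop}

instance Sig.and [hP : Sig P] [hQ : Sig Q] : Sig fun v => P v ∧ Q v := by
  obtain ⟨P', hP', h⟩ := hP
  obtain ⟨Q', hQ', h'⟩ := hQ
  refine ⟨fun v m => (∃ a, a < m ∧ P' v a) ∧ ∃ a, a < m ∧ Q' v a, ?_, fun v => ?_⟩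
  · have := hP'.reindex₂ (k := n + 2) (fun i => i.castSucc.castSucc) (Fin.last _)
    have := hQ'.reindex₂ (k := n + 2) (fun i => i.castSucc.castSucc) (Fin.last _)
    infer_instance
  · rw [h, h']
    constructor
    · rintro ⟨⟨a, ha⟩, b, hb⟩
      exact ⟨max a b + 1, ⟨a, lt_add_one_iff.2 (le_max_left _ _), ha⟩,
        b, lt_add_one_iff.2 (le_max_right _ _), hb⟩
    · rintro ⟨m, ⟨a, -, ha⟩, b, -, hb⟩
      exact ⟨⟨a, ha⟩, b, hb⟩

instance Sig.or [hP : Sig P] [hQ : Sig Q] : Sig fun v => P v ∨ Q v := by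
  obtain ⟨P', hP', h⟩ := hP
  obtain ⟨Q', hQ', h'⟩ := hQ
  exact ⟨fun v m => P' v m ∨ Q' v m, inferInstance, fun v => by rw [h, h', exists_or]⟩

instance Sig.ex [hR : Sig fun v : Fin (n + 1) → 𝔐 => R (fun i => v i.castSucc) (v (Fin.last n))] :
    Sig fun v => ∃ a, R v a := by
  obtain ⟨R', hR', h⟩ := hR
  refine ⟨fun v m => ∃ a, a < m ∧ ∃ b, b < m ∧ R' (Fin.snoc v a) b, ?_, fun v => ?_⟩
  · have := hR'.reindex (m := n + 3) (Fin.snoc (α := fun _ => Fin (n + 3))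
      (Fin.snoc (α := fun _ => Fin (n + 3)) (fun i => i.castSucc.castSucc.castSucc)
        (Fin.last _).castSucc) (Fin.last _))
    have h2 : IsBdd fun v : Fin (n + 3) → 𝔐 =>
        R' (Fin.snoc (fun i : Fin n => v i.castSucc.castSucc.castSucc)
          (v (Fin.last (n + 1)).castSucc)) (v (Fin.last (n + 2))) := by
      refine this.congr fun v => ?_
      simp only [Fin.snoc_castSucc, Fin.snoc_last]
      refine iff_of_eq (congrArg (fun w => R' w _) (funext fun i => ?_))
      refine Fin.lastCases ?_ (fun i => ?_) i <;> simp
    infer_instance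
  · have : ∀ a, R v a ↔ ∃ b, R' (Fin.snoc v a) b := fun a => by
      rw [← h]; simp
    simp only [this]
    constructor
    · rintro ⟨a, b, hb⟩
      exact ⟨max a b + 1, a, lt_add_one_iff.2 (le_max_left _ _),
        b, lt_add_one_iff.2 (le_max_right _ _), hb⟩
    · rintro ⟨m, a, -, b, -, hb⟩
      exact ⟨a, b, hb⟩

instance RecFun.var (i : Fin n) : RecFun fun v : Fin n → 𝔐 => v i :=
  ⟨IsBdd.sig inferInstance⟩

instance RecFun.const (c : 𝔐) : RecFun fun _ : Fin n → 𝔐 => c :=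
  ⟨IsBdd.sig inferInstance⟩

omit [IsModel 𝔐] in
theorem RecFun.reindex {f : (Fin n → 𝔐) → 𝔐} (hf : RecFun f) {k : ℕ} (σ : Fin n → Fin k)
    (j : Fin k) : Sig fun v : Fin k → 𝔐 => v j = f fun i => v (σ i) :=
  hf.graph.reindex₂ (R := fun v a => a = f v) σ j

omit [IsModel 𝔐] in
theorem RecFun.weaken {f : (Fin n → 𝔐) → 𝔐} (hf : RecFun f) {k : ℕ} (σ : Fin n → Fin k) :
    RecFun fun v : Fin k → 𝔐 => f fun i => v (σ i) :=
  ⟨hf.reindex (fun i => (σ i).castSucc) (Fin.last _)⟩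

theorem Sig.comp {f : (Fin n → 𝔐) → 𝔐} (hf : RecFun f)
    (hR : Sig fun v : Fin (n + 1) → 𝔐 => R (fun i => v i.castSucc) (v (Fin.last n))) :
    Sig fun v => R v (f v) := by
  have := hf.graph
  exact Sig.congr (P := fun v => ∃ a, a = f v ∧ R v a) inferInstance fun v => by simp

theorem Sig.comp₁ {A : 𝔐 → Prop} (hA : Sig fun v : Fin 1 → 𝔐 => A (v 0))
    (f : (Fin n → 𝔐) → 𝔐) [hf : RecFun f] : Sig fun v => A (f v) :=
  Sig.comp (R := fun _ a => A a) hf (hA.reindex fun _ => Fin.last n)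

theorem Rec.comp₁ {A : 𝔐 → Prop} (hA : Rec fun v : Fin 1 → 𝔐 => A (v 0))
    (f : (Fin n → 𝔐) → 𝔐) [hf : RecFun f] : Rec fun v => A (f v) :=
  ⟨hA.pos.comp₁ f, hA.neg.comp₁ (A := fun a => ¬ A a) f⟩

omit [IsModel 𝔐] in
instance RecFun.castSucc {f : (Fin n → 𝔐) → 𝔐} [hf : RecFun f] :
    RecFun fun v : Fin (n + 1) → 𝔐 => f fun i => v i.castSucc :=
  hf.weaken _

theorem Sig.comp₂ {A : 𝔐 → 𝔐 → Prop} (hA : Sig fun v : Fin 2 → 𝔐 => A (v 0) (v 1))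
    (f g : (Fin n → 𝔐) → 𝔐) [hf : RecFun f] [hg : RecFun g] : Sig fun v => A (f v) (g v) :=
  Sig.comp (R := fun v a => A a (g v)) hf <|
    Sig.comp (R := fun v a => A (v (Fin.last n)) a) RecFun.castSucc
      (hA.reindex ![(Fin.last n).castSucc, Fin.last (n + 1)])

theorem Rec.comp₂ {A : 𝔐 → 𝔐 → Prop} (hA : Rec fun v : Fin 2 → 𝔐 => A (v 0) (v 1))
    (f g : (Fin n → 𝔐) → 𝔐) [hf : RecFun f] [hg : RecFun g] : Rec fun v => A (f v) (g v) :=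
  ⟨hA.pos.comp₂ f g, hA.neg.comp₂ (A := fun a b => ¬ A a b) f g⟩

theorem Sig.comp₃ {A : 𝔐 → 𝔐 → 𝔐 → Prop} (hA : Sig fun v : Fin 3 → 𝔐 => A (v 0) (v 1) (v 2))
    (f g h : (Fin n → 𝔐) → 𝔐) [hf : RecFun f] [hg : RecFun g] [hh : RecFun h] :
    Sig fun v => A (f v) (g v) (h v) :=
  Sig.comp (R := fun v a => A a (g v) (h v)) hf <|
    Sig.comp (R := fun v a => A (v (Fin.last n)) a (h fun i => v i.castSucc)) RecFun.castSucc <|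
      Sig.comp (R := fun v a => A (v (Fin.last n).castSucc) (v (Fin.last (n + 1))) a)
        (RecFun.castSucc (f := fun v : Fin (n + 1) → 𝔐 => h fun i => v i.castSucc))
        (hA.reindex ![(Fin.last n).castSucc.castSucc, (Fin.last (n + 1)).castSucc,
          Fin.last (n + 2)])

theorem Rec.comp₃ {A : 𝔐 → 𝔐 → 𝔐 → Prop} (hA : Rec fun v : Fin 3 → 𝔐 => A (v 0) (v 1) (v 2))
    (f g h : (Fin n → 𝔐) → 𝔐) [hf : RecFun f] [hg : RecFun g] [hh : RecFun h] :
    Rec fun v => A (f v) (g v) (h v) :=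
  ⟨hA.pos.comp₃ f g h, hA.neg.comp₃ (A := fun a b c => ¬ A a b c) f g h⟩

theorem RecFun.comp₁ {F : 𝔐 → 𝔐} (hF : Sig fun v : Fin 2 → 𝔐 => v 1 = F (v 0))
    (f : (Fin n → 𝔐) → 𝔐) [hf : RecFun f] : RecFun fun v => F (f v) :=
  have := hf.weaken (k := n + 1) Fin.castSucc
  ⟨hF.comp₂ (A := fun a b => b = F a) (fun v => f fun i => v i.castSucc) fun v => v (Fin.last n)⟩

theorem RecFun.comp₂ {F : 𝔐 → 𝔐 → 𝔐} (hF : Sig fun v : Fin 3 → 𝔐 => v 2 = F (v 0) (v 1))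
    (f g : (Fin n → 𝔐) → 𝔐) [hf : RecFun f] [hg : RecFun g] : RecFun fun v => F (f v) (g v) :=
  have := hf.weaken (k := n + 1) Fin.castSucc
  have := hg.weaken (k := n + 1) Fin.castSucc
  ⟨hF.comp₃ (A := fun a b c => c = F a b) (fun v => f fun i => v i.castSucc)
    (fun v => g fun i => v i.castSucc) fun v => v (Fin.last n)⟩

section atomic

variable {f g : (Fin n → 𝔐) → 𝔐} [hf : RecFun f] [hg : RecFun g]

instance RecFun.add : RecFun fun v => f v + g v := .comp₂ (IsBdd.sig inferInstance) f g

instance RecFun.mul : RecFun fun v => f v * g v := .comp₂ (IsBdd.sig inferInstance) f g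

instance RecFun.pair : RecFun fun v => L2Structure.pair (f v) (g v) := by
  unfold L2Structure.pair; infer_instance

instance Rec.eq : Rec fun v => f v = g v :=
  .comp₂ (A := fun a b => a = b) (IsBdd.isRec inferInstance) f g

instance Rec.lt : Rec fun v => f v < g v :=
  .comp₂ (A := fun a b => a < b) (IsBdd.isRec inferInstance) f g

instance Rec.mem {X : Set 𝔐} [IsSet X] : Rec fun v => f v ∈ X :=
  .comp₁ (A := fun a => a ∈ X) (IsBdd.isRec inferInstance) f

end atomic

instance Rec.and [hP : Rec P] [hQ : Rec Q] : Rec fun v => P v ∧ Q v :=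
  ⟨inferInstance, Sig.congr (P := fun v => ¬ P v ∨ ¬ Q v) inferInstance fun v => by tauto⟩

instance Rec.or [hP : Rec P] [hQ : Rec Q] : Rec fun v => P v ∨ Q v :=
  ⟨inferInstance, Sig.congr (P := fun v => ¬ P v ∧ ¬ Q v) inferInstance fun v => by tauto⟩

instance Rec.imp [hP : Rec P] [hQ : Rec Q] : Rec fun v => P v → Q v :=
  Rec.congr (P := fun v => ¬ P v ∨ Q v) inferInstance fun v => by tauto

instance Rec.iff [hP : Rec P] [hQ : Rec Q] : Rec fun v => (P v ↔ Q v) :=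
  Rec.congr (P := fun v => (P v → Q v) ∧ (Q v → P v)) inferInstance fun v => by tauto

instance Sig.imp [hP : Rec P] [hQ : Sig Q] : Sig fun v => P v → Q v :=
  Sig.congr (P := fun v => ¬ P v ∨ Q v) inferInstance fun v => by tauto

theorem collection_bdd {R : 𝔐 → 𝔐 → Prop} [hR : IsBdd fun v : Fin 2 → 𝔐 => R (v 0) (v 1)] {b : 𝔐}
    (h : ∀ a, a < b → ∃ m, R a m) : ∃ c, ∀ a, a < b → ∃ m, m < c ∧ R a m := by
  have : ∀ {k} (i j : Fin k), IsBdd fun v : Fin k → 𝔐 => R (v i) (v j) := fun i j =>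
    hR.reindex ![i, j]
  have key := exists_induction (Q := fun d c => ∀ a, a < d → a < b → ∃ m, m < c ∧ R a m)
    ⟨0, fun a ha => (not_lt_zero' _ ha).elim⟩ ?_ b
  · obtain ⟨c, hc⟩ := key
    exact ⟨c, fun a ha => hc a ha ha⟩
  · rintro d ⟨c, hc⟩
    by_cases hd : d < b
    · obtain ⟨m, hm⟩ := h d hd
      refine ⟨max c (m + 1), fun a ha hab => ?_⟩
      rcases lt_succ'.1 ha with ha | rfl
      · obtain ⟨m', hm', hr⟩ := hc a ha hab
        exact ⟨m', lt_max_of_lt_left hm', hr⟩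
      · exact ⟨m, lt_max_of_lt_right (lt_add_one_iff.2 le_rfl), hm⟩
    · refine ⟨c, fun a ha hab => hc a ?_ hab⟩
      rcases lt_succ'.1 ha with ha | rfl
      exacts [ha, (hd hab).elim]

instance Sig.ball {f : (Fin n → 𝔐) → 𝔐} [hf : RecFun f]
    [hR : Sig fun v : Fin (n + 1) → 𝔐 => R (fun i => v i.castSucc) (v (Fin.last n))] :
    Sig fun v => ∀ a, a < f v → R v a := by
  refine Sig.comp (R := fun v b => ∀ a, a < b → R v a) hf ?_
  obtain ⟨R', hR', h⟩ := hR
  have h1 : ∀ v a, R v a ↔ ∃ m, R' (Fin.snoc v a) m := fun v a => by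
    rw [← h]; simp
  have h2 : ∀ {k} {t : Fin n → (Fin k → 𝔐) → 𝔐} (_ : ∀ i, IsTerm (t i)) (i j : Fin k),
      IsBdd fun w : Fin k → 𝔐 => R' (Fin.snoc (fun i => t i w) (w i)) (w j) := fun {k t} ht i j => by
    let τ : Fin (n + 2) → (Fin k → 𝔐) → 𝔐 := Fin.snoc (α := fun _ => (Fin k → 𝔐) → 𝔐)
      (Fin.snoc (α := fun _ => (Fin k → 𝔐) → 𝔐) t fun v => v i) fun v => v j
    have hτ : ∀ l, IsTerm (τ l) := by
      refine Fin.lastCases ?_ (Fin.lastCases ?_ fun l => ?_)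
      · simpa [τ] using IsTerm.var _
      · simpa [τ] using IsTerm.var _
      · simpa [τ] using ht l
    refine (hR'.subst hτ).congr fun v => ?_
    simp only [τ, Fin.snoc_castSucc, Fin.snoc_last]
    refine iff_of_eq (congrArg (fun w => R' w _) (funext fun i => ?_))
    refine Fin.lastCases ?_ (fun i => ?_) i <;> simp
  refine ⟨fun v c => ∀ a, a < v (Fin.last n) → ∃ m, m < c ∧
    R' (Fin.snoc (fun i : Fin n => v i.castSucc) a) m, ?_, fun v => ?_⟩
  · have := h2 (k := n + 4) (t := fun i v => v i.castSucc.castSucc.castSucc.castSucc)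
      (fun i => .var _) (Fin.last _).castSucc (Fin.last _)
    infer_instance
  · simp only [h1]
    constructor
    · intro hv
      have := h2 (k := 2) (t := fun i _ => v i.castSucc) (fun i => .const _) 0 1
      exact collection_bdd (R := fun a m => R' (Fin.snoc (fun i : Fin n => v i.castSucc) a) m) hv
    · rintro ⟨c, hc⟩ a ha
      obtain ⟨m, -, hm⟩ := hc a ha
      exact ⟨m, hm⟩

instance Rec.bex {f : (Fin n → 𝔐) → 𝔐} [hf : RecFun f]
    [hR : Rec fun v : Fin (n + 1) → 𝔐 => R (fun i => v i.castSucc) (v (Fin.last n))] :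
    Rec fun v => ∃ a, a < f v ∧ R v a :=
  ⟨inferInstance, Sig.congr (P := fun v => ∀ a, a < f v → ¬ R v a) inferInstance fun v => by simp⟩

instance Rec.ball {f : (Fin n → 𝔐) → 𝔐} [hf : RecFun f]
    [hR : Rec fun v : Fin (n + 1) → 𝔐 => R (fun i => v i.castSucc) (v (Fin.last n))] :
    Rec fun v => ∀ a, a < f v → R v a :=
  ⟨inferInstance, Sig.congr (P := fun v => ∃ a, a < f v ∧ ¬ R v a) inferInstance fun v => by simp⟩

end closure

end L2Structure

/-! ### Coding of finite sets -/

namespace L2Structure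

variable {𝔐 : L2Structure.{u}} [h𝔐 : IsModel 𝔐]

section basic

omit h𝔐 in
theorem Sig.isSigma01 {P : 𝔐 → Prop} (hP : Sig fun v : Fin 1 → 𝔐 => P (v 0)) :
    𝔐.IsSigma01 {a | P a} := by
  obtain ⟨Q, hQ, h⟩ := hP
  exact hQ.isSigma01 fun a => by
    have h1 := h ![a]
    have h2 : ∀ m, (fun i : Fin 1 => ![a, m] i.castSucc) = ![a] := fun m => by
      ext i; rw [Subsingleton.elim i 0]; rfl
    simpa [h2] using h1

theorem setOf_mem_sets {P : 𝔐 → Prop} [hP : Rec fun v : Fin 1 → 𝔐 => P (v 0)] :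
    {a | P a} ∈ 𝔐.sets :=
  h𝔐.models.delta01_comprehension _ (Sig.isSigma01 hP.pos)
    (Sig.isSigma01 (P := fun a => ¬ P a) hP.neg)

instance isSet_setOf {P : 𝔐 → Prop} [Rec fun v : Fin 1 → 𝔐 => P (v 0)] : IsSet {a | P a} :=
  ⟨setOf_mem_sets⟩

omit h𝔐 in
theorem Sig.subst {n m : ℕ} {P : (Fin n → 𝔐) → Prop} (hP : Sig P)
    {τ : Fin n → (Fin m → 𝔐) → 𝔐} (hτ : ∀ i, IsTerm (τ i)) : Sig fun v => P fun i => τ i v := by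
  obtain ⟨Q, hQ, h⟩ := hP
  refine ⟨fun v c => Q (fun i => τ i v) c, ?_, fun v => h _⟩
  have : ∀ i, IsTerm ((Fin.snoc (α := fun _ => (Fin (m + 1) → 𝔐) → 𝔐)
      (fun i v => τ i fun j => v j.castSucc) fun v => v (Fin.last m) :
      Fin (n + 1) → (Fin (m + 1) → 𝔐) → 𝔐) i) := by
    refine Fin.lastCases ?_ fun i => ?_
    · simpa using IsTerm.var _
    · simpa using (hτ i).subst fun j => IsTerm.var j.castSucc
  simpa using hQ.subst this

omit h𝔐 in
theorem Rec.subst {n m : ℕ} {P : (Fin n → 𝔐) → Prop} (hP : Rec P)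
    {τ : Fin n → (Fin m → 𝔐) → 𝔐} (hτ : ∀ i, IsTerm (τ i)) : Rec fun v => P fun i => τ i v :=
  ⟨hP.pos.subst hτ, hP.neg.subst hτ⟩

omit h𝔐 in
theorem Rec.section {n : ℕ} {R : (Fin n → 𝔐) → 𝔐 → Prop}
    (hR : Rec fun v : Fin (n + 1) → 𝔐 => R (fun i => v i.castSucc) (v (Fin.last n)))
    (v : Fin n → 𝔐) : Rec fun w : Fin 1 → 𝔐 => R v (w 0) := by
  have : ∀ i, IsTerm ((Fin.snoc (α := fun _ => (Fin 1 → 𝔐) → 𝔐) (fun i _ => v i) fun w => w 0 :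
      Fin (n + 1) → (Fin 1 → 𝔐) → 𝔐) i) := by
    refine Fin.lastCases ?_ fun i => ?_
    · simpa using IsTerm.var _
    · simpa using IsTerm.const _
  simpa using hR.subst this

instance Rec.bex_le {n : ℕ} {R : (Fin n → 𝔐) → 𝔐 → Prop} {f : (Fin n → 𝔐) → 𝔐} [RecFun f]
    [Rec fun v : Fin (n + 1) → 𝔐 => R (fun i => v i.castSucc) (v (Fin.last n))] :
    Rec fun v => ∃ a, a ≤ f v ∧ R v a :=
  Rec.congr (P := fun v => ∃ a, a < f v + 1 ∧ R v a) inferInstance fun v => by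
    simp only [lt_add_one_iff]

theorem exists_least {P : 𝔐 → Prop} [hP : Rec fun v : Fin 1 → 𝔐 => P (v 0)] (h : ∃ a, P a) :
    ∃ a, P a ∧ ∀ b, b < a → ¬ P b := by
  have : ∀ {k} (i : Fin k), Rec fun v : Fin k → 𝔐 => P (v i) := fun i => hP.reindex fun _ => i
  by_contra! hc
  have key : ∀ a, ∀ b, b < a → ¬ P b := by
    refine exists_induction_sig (P := fun a => ∀ b, b < a → ¬ P b)
      (fun b hb => (not_lt_zero' _ hb).elim) fun n hn b hb hPb => ?_
    obtain ⟨c, hc, hPc⟩ := hc b hPb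
    rcases lt_succ'.1 hb with hb | rfl
    exacts [hn b hb hPb, hn c hc hPc]
  obtain ⟨a, ha⟩ := h
  exact key (a + 1) a (lt_add_one_iff.2 le_rfl) ha

theorem exists_recFun {G : 𝔐 → 𝔐 → Prop} (hG : Rec fun v : Fin 2 → 𝔐 => G (v 0) (v 1))
    (h : ∀ x, ∃ y, G x y) :
    ∃ f : 𝔐 → 𝔐, (Sig fun v : Fin 2 → 𝔐 => v 1 = f (v 0)) ∧ ∀ x, G x (f x) := by
  have h1 : ∀ {n} (f g : (Fin n → 𝔐) → 𝔐) [RecFun f] [RecFun g], Rec fun v => G (f v) (g v) :=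
    fun f g => hG.comp₂ f g
  have := fun x => exists_least (P := G x) (h x)
  choose f hf hf' using this
  refine ⟨f, ?_, hf⟩
  refine Sig.congr (P := fun v : Fin 2 → 𝔐 => G (v 0) (v 1) ∧ ∀ b, b < v 1 → ¬ G (v 0) b) inferInstance
    fun v => ⟨fun h => h ▸ ⟨hf _, hf' _⟩, fun h => ?_⟩
  rcases lt_trichotomy (v 1) (f (v 0)) with h' | h' | h'
  exacts [(hf' _ _ h' h.1).elim, h', (h.2 _ h' (hf _)).elim]

theorem one_le_iff' {a : 𝔐} : 1 ≤ a ↔ 0 < a := by rw [← succ_le_iff', zero_add]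

theorem le_mul_self' (a : 𝔐) : a ≤ a * a := by
  rcases eq_zero_or_succ' a with rfl | ⟨b, rfl⟩
  · simp
  · calc b + 1 ≤ (b + 1) + (b + 1) * b := le_self_add
      _ = _ := by ring

theorem le_pair_left (a b : 𝔐) : a ≤ pair a b := le_add_self

theorem le_pair_right (a b : 𝔐) : b ≤ pair a b :=
  calc b ≤ a + b := le_add_self
    _ ≤ (a + b) * (a + b) := le_mul_self' _
    _ ≤ _ := le_self_add

theorem pair_lt_of_add_lt {a b c d : 𝔐} (h : a + b < c + d) : pair a b < pair c d :=
  calc pair a b ≤ (a + b) * (a + b) + (a + b) := add_le_add_right le_self_add _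
    _ < (a + b) * (a + b) + (a + b) + (a + b + 1) := lt_iff_exists'.2 ⟨_, rfl⟩
    _ = (a + b + 1) * (a + b + 1) := by ring
    _ ≤ (c + d) * (c + d) := mul_le_mul' (succ_le_iff'.2 h) (succ_le_iff'.2 h)
    _ ≤ pair c d := le_self_add

theorem pair_inj {a b c d : 𝔐} : pair a b = pair c d ↔ a = c ∧ b = d := by
  refine ⟨fun h => ?_, fun h => by rw [h.1, h.2]⟩
  rcases lt_trichotomy (a + b) (c + d) with h' | h' | h'
  · exact ((pair_lt_of_add_lt h').ne h).elim
  · have : a = c := by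
      unfold pair at h
      rw [h'] at h
      exact add_left_cancel h
    subst this
    exact ⟨rfl, add_left_cancel h'⟩
  · exact ((pair_lt_of_add_lt h').ne' h).elim

theorem pair_le_pair {a b c d : 𝔐} (h : a ≤ c) (h' : b ≤ d) : pair a b ≤ pair c d :=
  add_le_add (mul_le_mul' (add_le_add h h') (add_le_add h h')) h

theorem le_of_dvd' {a b : 𝔐} (hb : 0 < b) (h : a ∣ b) : a ≤ b := by
  obtain ⟨q, rfl⟩ := h
  have : 0 < q := pos_of_ne_zero fun h => by simp [h] at hb
  exact le_mul_of_one_le_right' (one_le_iff'.2 this)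

theorem dvd_of_dvd_add {d a b : 𝔐} (hd : 0 < d) (ha : d ∣ a) (hab : d ∣ a + b) : d ∣ b := by
  obtain ⟨p, rfl⟩ := ha
  obtain ⟨q, hq⟩ := hab
  have : d * p ≤ d * q := hq ▸ le_self_add
  obtain ⟨r, rfl⟩ := le_iff_exists'.1 (le_of_mul_le_mul_left this hd)
  exact ⟨r, add_left_cancel (a := d * p) (by rw [hq]; ring)⟩

instance Rec.dvd {n : ℕ} {f g : (Fin n → 𝔐) → 𝔐} [RecFun f] [RecFun g] :
    Rec fun v => f v ∣ g v := by
  refine Rec.congr (P := fun v => ∃ q, q ≤ g v ∧ g v = f v * q) inferInstance fun v => ?_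
  refine ⟨fun h => ?_, fun ⟨q, _, h⟩ => ⟨q, h⟩⟩
  rcases eq_or_ne (g v) 0 with h0 | h0
  · exact ⟨0, zero_le, by simp [h0]⟩
  · obtain ⟨q, hq⟩ := h
    exact ⟨q, le_of_dvd' (pos_of_ne_zero h0) ⟨f v, by rw [hq, mul_comm]⟩, hq⟩

theorem exists_common_multiple (k : 𝔐) : ∃ m : 𝔐, 0 < m ∧ ∀ j, j < k → j + 1 ∣ m := by
  refine exists_induction_sig (P := fun k : 𝔐 => ∃ m : 𝔐, 0 < m ∧ ∀ j, j < k → j + 1 ∣ m)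
    ⟨1, one_pos, fun j hj => (not_lt_zero' _ hj).elim⟩ ?_ k
  rintro k ⟨m, hm, h⟩
  refine ⟨m * (k + 1), mul_pos hm (by positivity), fun j hj => ?_⟩
  rcases lt_succ'.1 hj with hj | rfl
  exacts [(h j hj).mul_right _, dvd_mul_left _ _]

theorem exists_common_multiple_progression (m k : 𝔐) :
    ∃ N : 𝔐, 0 < N ∧ ∀ i, i < k → m * (i + 1) + 1 ∣ N := by
  refine exists_induction_sig
    (P := fun k : 𝔐 => ∃ N : 𝔐, 0 < N ∧ ∀ i, i < k → m * (i + 1) + 1 ∣ N)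
    ⟨1, one_pos, fun j hj => (not_lt_zero' _ hj).elim⟩ ?_ k
  rintro k ⟨N, hN, h⟩
  refine ⟨N * (m * (k + 1) + 1), mul_pos hN (by positivity), fun j hj => ?_⟩
  rcases lt_succ'.1 hj with hj | rfl
  exacts [(h j hj).mul_right _, dvd_mul_left _ _]

theorem dvd_of_progression_dvd_mul {m i x : 𝔐} (h : m * (i + 1) + 1 ∣ m * x) :
    m * (i + 1) + 1 ∣ x :=
  dvd_of_dvd_add (by positivity) (h.mul_right (i + 1))
    ⟨x, by ring⟩

theorem dvd_of_progression_dvd_progression_mul {m k i j x : 𝔐} (hm : ∀ l, l < k → l + 1 ∣ m)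
    (hi : i < k) (hj : j < k) (hij : i ≠ j) (h : m * (i + 1) + 1 ∣ (m * (j + 1) + 1) * x) :
    m * (i + 1) + 1 ∣ x := by
  have key : ∀ l, l < k → m * (i + 1) + 1 ∣ m * ((l + 1) * x) → m * (i + 1) + 1 ∣ x := by
    intro l hl hd
    obtain ⟨c, hc⟩ := hm l hl
    have := (dvd_of_progression_dvd_mul hd).mul_left c
    refine dvd_of_progression_dvd_mul (this.trans (dvd_of_eq ?_))
    rw [hc]; ring
  rcases lt_or_gt_of_ne hij with h' | h'
  · obtain ⟨l, rfl⟩ := lt_iff_exists'.1 h'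
    refine key l (lt_of_lt_of_le (lt_add_one_iff.2 le_rfl) (le_add_self.trans hj.le)) ?_
    exact dvd_of_dvd_add (by positivity) (dvd_mul_right _ x) (h.trans (dvd_of_eq (by ring)))
  · obtain ⟨l, rfl⟩ := lt_iff_exists'.1 h'
    refine key l (lt_of_lt_of_le (lt_add_one_iff.2 le_rfl) (le_add_self.trans hi.le)) ?_
    exact dvd_of_dvd_add (by positivity) h ⟨x, by ring⟩

theorem exists_dvd_iff {m k N : 𝔐} (hm0 : 0 < m) (hm : ∀ l, l < k → l + 1 ∣ m)
    (hN : ∀ i, i < k → m * (i + 1) + 1 ∣ N)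
    {P : 𝔐 → Prop} [hP : Rec fun v : Fin 1 → 𝔐 => P (v 0)] :
    ∃ n, n ∣ N ∧ ∀ i, i < k → (m * (i + 1) + 1 ∣ n ↔ P i) := by
  have : ∀ {k} (i : Fin k), Rec fun v : Fin k → 𝔐 => P (v i) := fun i => hP.reindex fun _ => i
  have key : ∀ j, j ≤ k → ∃ n q, N = n * q ∧
      (∀ i, i < k → j ≤ i → m * (i + 1) + 1 ∣ q) ∧
      ∀ i, i < k → (m * (i + 1) + 1 ∣ n ↔ i < j ∧ P i) := by
    refine exists_induction_sig (P := fun j => j ≤ k → ∃ n q, N = n * q ∧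
      (∀ i, i < k → j ≤ i → m * (i + 1) + 1 ∣ q) ∧
      ∀ i, i < k → (m * (i + 1) + 1 ∣ n ↔ i < j ∧ P i)) ?_ ?_
    · refine fun _ => ⟨1, N, (one_mul _).symm, fun i hi _ => hN i hi, fun i _ => ?_⟩
      refine ⟨fun h => ?_, fun h => (not_lt_zero' _ h.1).elim⟩
      have := le_of_dvd' one_pos h
      have h2 : (1 : 𝔐) < m * (i + 1) + 1 := by
        rw [lt_add_iff_pos_left]; positivity
      exact (this.not_gt h2).elim
    · intro j ih hj
      have hjk : j < k := succ_le_iff'.1 hj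
      obtain ⟨n, q, hnq, hq, hn⟩ := ih hjk.le
      by_cases hPj : P j
      · obtain ⟨q', rfl⟩ := hq j hjk le_rfl
        refine ⟨n * (m * (j + 1) + 1), q', by rw [hnq]; ring, fun i hi hij => ?_, fun i hi => ?_⟩
        · have hij : j < i := succ_le_iff'.1 hij
          exact dvd_of_progression_dvd_progression_mul hm hi hjk hij.ne' (hq i hi hij.le)
        · rcases eq_or_ne i j with rfl | hij
          · exact ⟨fun _ => ⟨lt_add_one_iff.2 le_rfl, hPj⟩, fun _ => dvd_mul_left _ _⟩
          · rw [show i < j + 1 ↔ i < j from lt_add_one_iff.trans ⟨fun h => h.lt_of_ne hij, le_of_lt⟩,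
              ← hn i hi]
            refine ⟨fun h => ?_, fun h => h.mul_right _⟩
            exact dvd_of_progression_dvd_progression_mul hm hi hjk hij (by rwa [mul_comm n] at h)
      · refine ⟨n, q, hnq, fun i hi hij => hq i hi (le_self_add.trans hij), fun i hi => ?_⟩
        rw [hn i hi]
        refine and_congr_left fun hPi => ⟨fun h => lt_succ'.2 (.inl h), fun h => ?_⟩
        rcases lt_succ'.1 h with h | rfl
        exacts [h, (hPj hPi).elim]
  obtain ⟨n, q, hnq, -, hn⟩ := key k le_rfl
  refine ⟨n, ⟨q, hnq⟩, fun i hi => ?_⟩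
  rw [hn i hi]; tauto

end basic

section codes

variable {n : ℕ}

theorem elem_pair {i k m x : 𝔐} : Elem i (pair k (pair m x)) ↔ i < k ∧ m * (i + 1) + 1 ∣ x := by
  constructor
  · rintro ⟨k', m', x', h, hi, q, hq⟩
    obtain ⟨h1, h2⟩ := pair_inj.1 h
    obtain ⟨h2, h3⟩ := pair_inj.1 h2
    subst h1 h2 h3
    exact ⟨hi, q, hq⟩
  · rintro ⟨hi, q, hq⟩
    exact ⟨k, m, x, rfl, hi, q, hq⟩

theorem Elem.lt {i c : 𝔐} (h : Elem i c) : i < c := by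
  obtain ⟨k, m, n, rfl, hi, -⟩ := h
  exact hi.trans_le (le_pair_left _ _)

instance Rec.elem {f g : (Fin n → 𝔐) → 𝔐} [RecFun f] [RecFun g] :
    Rec fun v => Elem (f v) (g v) := by
  refine Rec.comp₂ (Rec.congr (P := fun v => ∃ k, k ≤ v 1 ∧ ∃ m, m ≤ v 1 ∧ ∃ x, x ≤ v 1 ∧
    v 1 = pair k (pair m x) ∧ v 0 < k ∧ m * (v 0 + 1) + 1 ∣ x) inferInstance fun v => ?_) f g
  constructor
  · rintro ⟨k, m, x, h, hi, hq⟩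
    have h1 : pair m x ≤ v 1 := h ▸ le_pair_right _ _
    exact ⟨k, h ▸ le_pair_left _ _, m, (le_pair_left _ _).trans h1, x,
      (le_pair_right _ _).trans h1, h, hi, hq⟩
  · rintro ⟨k, -, m, -, x, -, h, hi, hq⟩
    exact ⟨k, m, x, h, hi, hq⟩

instance Rec.ball_elem {R : (Fin n → 𝔐) → 𝔐 → Prop} {f : (Fin n → 𝔐) → 𝔐} [RecFun f]
    [Rec fun v : Fin (n + 1) → 𝔐 => R (fun i => v i.castSucc) (v (Fin.last n))] :
    Rec fun v => ∀ a, Elem a (f v) → R v a :=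
  have := fun {k} => RecFun.weaken ‹RecFun f› (k := k)
  Rec.congr (P := fun v => ∀ a, a < f v → Elem a (f v) → R v a) inferInstance fun _ =>
    ⟨fun h a _ ha => h a ha, fun h a ha => h a ha.lt ha⟩

instance Rec.isCode {f : (Fin n → 𝔐) → 𝔐} [RecFun f] : Rec fun v => IsCode (f v) := by
  refine Rec.comp₁ (Rec.congr (P := fun v => ∀ c', c' < v 0 → ∃ i, i < v 0 ∧
    ¬ (Elem i c' ↔ Elem i (v 0))) inferInstance fun v => forall₂_congr fun c' hc' => ?_) f
  refine ⟨fun ⟨i, hi⟩ => ⟨i, ?_, hi⟩, fun ⟨i, _, hi⟩ => ⟨i, hi⟩⟩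
  by_contra h
  exact hi ⟨fun h' => (h (h'.lt.trans hc')).elim, fun h' => (h h'.lt).elim⟩

theorem IsCode.ext {c c' : 𝔐} (hc : IsCode c) (hc' : IsCode c')
    (h : ∀ i, Elem i c ↔ Elem i c') : c = c' := by
  rcases lt_trichotomy c c' with h' | h' | h'
  · obtain ⟨i, hi⟩ := hc' c h'
    exact (hi (h i)).elim
  · exact h'
  · obtain ⟨i, hi⟩ := hc c' h'
    exact (hi (h i).symm).elim

theorem exists_code_lt (k : 𝔐) : ∃ B, ∃ m, m < B ∧ ∃ N, N < B ∧ B = pair k (pair m N) + 1 ∧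
    0 < m ∧ (∀ l, l < k → l + 1 ∣ m) ∧ 0 < N ∧ ∀ i, i < k → m * (i + 1) + 1 ∣ N := by
  obtain ⟨m, hm, h⟩ := exists_common_multiple k
  obtain ⟨N, hN, h'⟩ := exists_common_multiple_progression m k
  refine ⟨_, m, ?_, N, ?_, rfl, hm, h, hN, h'⟩
  · exact lt_add_one_iff.2 ((le_pair_left _ _).trans (le_pair_right _ _))
  · exact lt_add_one_iff.2 ((le_pair_right _ _).trans (le_pair_right _ _))

theorem exists_codeBound : ∃ f : 𝔐 → 𝔐, (Sig fun v : Fin 2 → 𝔐 => v 1 = f (v 0)) ∧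
    ∀ k, ∃ m, m < f k ∧ ∃ N, N < f k ∧ f k = pair k (pair m N) + 1 ∧
      0 < m ∧ (∀ l, l < k → l + 1 ∣ m) ∧ 0 < N ∧ ∀ i, i < k → m * (i + 1) + 1 ∣ N :=
  exists_recFun (G := fun k B => ∃ m, m < B ∧ ∃ N, N < B ∧ B = pair k (pair m N) + 1 ∧
    0 < m ∧ (∀ l, l < k → l + 1 ∣ m) ∧ 0 < N ∧ ∀ i, i < k → m * (i + 1) + 1 ∣ N)
    inferInstance exists_code_lt

/-- A bound on the canonical codes of the sets of numbers below `k`. -/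
noncomputable def codeBound (k : 𝔐) : 𝔐 := exists_codeBound.choose k

instance RecFun.codeBound {f : (Fin n → 𝔐) → 𝔐} [RecFun f] : RecFun fun v => codeBound (f v) :=
  .comp₁ exists_codeBound.choose_spec.1 f

theorem exists_isCode (k : 𝔐) (P : 𝔐 → Prop) [hP : Rec fun v : Fin 1 → 𝔐 => P (v 0)] :
    ∃ c, (IsCode c ∧ ∀ i, Elem i c ↔ i < k ∧ P i) ∧ c < codeBound k := by
  have : ∀ {k} (i : Fin k), Rec fun v : Fin k → 𝔐 => P (v i) := fun i => hP.reindex fun _ => i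
  obtain ⟨m, -, N, -, hB, hm0, hm, hN0, hN⟩ := exists_codeBound.choose_spec.2 k
  obtain ⟨n, hn, h⟩ := exists_dvd_iff hm0 hm hN (P := P)
  have h1 : ∀ i, Elem i (pair k (pair m n)) ↔ i < k ∧ P i := fun i => by
    rw [elem_pair]; exact and_congr_right fun hi => h i hi
  have h2 : pair k (pair m n) < codeBound k := by
    unfold codeBound
    rw [hB, lt_add_one_iff]
    exact pair_le_pair le_rfl (pair_le_pair le_rfl (le_of_dvd' hN0 hn))
  have h3 : ∀ c, (∀ i, Elem i c ↔ i < k ∧ P i) ↔ ∀ i, i < c + k → (Elem i c ↔ i < k ∧ P i) :=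
    fun c => by
      refine ⟨fun h i _ => h i, fun h i => ?_⟩
      by_cases hi : i < c + k
      · exact h i hi
      · rw [not_lt] at hi
        exact ⟨fun h' => (h'.lt.not_ge (le_self_add.trans hi)).elim,
          fun h' => (h'.1.not_ge (le_add_self.trans hi)).elim⟩
  obtain ⟨c, hc, hc'⟩ := exists_least (P := fun c => ∀ i, i < c + k → (Elem i c ↔ i < k ∧ P i))
    ⟨_, (h3 _).1 h1⟩
  rw [← h3] at hc
  refine ⟨c, ⟨fun c' h' => ?_, hc⟩, lt_of_le_of_lt ?_ h2⟩
  · by_contra! hne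
    exact hc' c' h' ((h3 _).1 fun i => (hne i).trans (hc i))
  · by_contra! hlt
    exact hc' _ hlt ((h3 _).1 h1)

open Classical in
/-- The canonical code of the set of the numbers below `k` with property `P`. -/
noncomputable def code (k : 𝔐) (P : 𝔐 → Prop) : 𝔐 :=
  if h : ∃ c, (IsCode c ∧ ∀ i, Elem i c ↔ i < k ∧ P i) ∧ c < codeBound k then h.choose else 0

section

variable {k : 𝔐} {P : 𝔐 → Prop} [Rec fun v : Fin 1 → 𝔐 => P (v 0)]

theorem code_spec : (IsCode (code k P) ∧ ∀ i, Elem i (code k P) ↔ i < k ∧ P i) ∧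
    code k P < codeBound k := by
  unfold code
  rw [dif_pos (exists_isCode k P)]
  exact (exists_isCode k P).choose_spec

theorem isCode_code : IsCode (code k P) := code_spec.1.1

@[simp]
theorem elem_code {i : 𝔐} : Elem i (code k P) ↔ i < k ∧ P i := code_spec.1.2 i

theorem code_lt : code k P < codeBound k := code_spec.2

theorem isVec_code : IsVec k (code k P) := ⟨isCode_code, fun _ h => (elem_code.1 h).1⟩

end

theorem IsVec.code_eq {k c : 𝔐} (hc : IsVec k c) : code k (fun i => Elem i c) = c :=
  isCode_code.ext hc.1 fun i => elem_code.trans ⟨fun h => h.2, fun h => ⟨hc.2 i h, h⟩⟩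

theorem IsVec.lt {k c : 𝔐} (hc : IsVec k c) : c < codeBound k := by
  rw [← hc.code_eq]; exact code_lt

theorem IsVec.ext {k c c' : 𝔐} (hc : IsVec k c) (hc' : IsVec k c')
    (h : ∀ i, i < k → (Elem i c ↔ Elem i c')) : c = c' :=
  hc.1.ext hc'.1 fun i => ⟨fun hi => (h i (hc.2 i hi)).1 hi, fun hi => (h i (hc'.2 i hi)).2 hi⟩

instance RecFun.code {f : (Fin n → 𝔐) → 𝔐} [hf : RecFun f] {R : (Fin n → 𝔐) → 𝔐 → Prop}
    [hR : Rec fun v : Fin (n + 1) → 𝔐 => R (fun i => v i.castSucc) (v (Fin.last n))] :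
    RecFun fun v => code (f v) fun i => R v i := by
  have : ∀ {k} (σ : Fin n → Fin k) (j : Fin k), Rec fun v : Fin k → 𝔐 =>
      R (fun i => v (σ i)) (v j) := fun σ j => by
    simpa using hR.reindex (Fin.snoc (α := fun _ => Fin _) σ j)
  have := fun {k} => hf.weaken (k := k)
  refine ⟨Sig.congr (P := fun v => IsCode (v (Fin.last n)) ∧
    ∀ i, i < v (Fin.last n) + f (fun i => v i.castSucc) →
      (Elem i (v (Fin.last n)) ↔ i < f (fun i => v i.castSucc) ∧ R (fun i => v i.castSucc) i))
    inferInstance fun v => ?_⟩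
  have := hR.section fun i => v i.castSucc
  refine ⟨fun h => by simp [h, isCode_code], fun h => h.1.ext isCode_code fun i => ?_⟩
  rw [elem_code]
  by_cases hi : i < v (Fin.last n) + f fun i => v i.castSucc
  · exact h.2 i hi
  · rw [not_lt] at hi
    exact ⟨fun h' => (h'.lt.not_ge (le_self_add.trans hi)).elim,
      fun h' => (h'.1.not_ge (le_add_self.trans hi)).elim⟩

instance Rec.isVec {f g : (Fin n → 𝔐) → 𝔐} [RecFun f] [RecFun g] :
    Rec fun v => IsVec (f v) (g v) := by
  unfold IsVec; infer_instance

instance Rec.ball_elem_pair {R : (Fin n → 𝔐) → 𝔐 → 𝔐 → Prop} {f : (Fin n → 𝔐) → 𝔐} [RecFun f]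
    [Rec fun v : Fin (n + 2) → 𝔐 => R (fun i => v i.castSucc.castSucc) (v (Fin.last n).castSucc)
      (v (Fin.last (n + 1)))] :
    Rec fun v => ∀ a b, Elem (pair a b) (f v) → R v a b :=
  have := fun {k} => RecFun.weaken ‹RecFun f› (k := k)
  Rec.congr (P := fun v => ∀ a, a < f v → ∀ b, b < f v → Elem (pair a b) (f v) → R v a b)
    inferInstance fun _ => ⟨fun h a _ b _ hab => h a b hab, fun h a b hab =>
      h a ((le_pair_left _ _).trans_lt hab.lt) b ((le_pair_right _ _).trans_lt hab.lt) hab⟩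

instance Rec.sat {R : (Fin n → 𝔐) → 𝔐 → Prop} {f : (Fin n → 𝔐) → 𝔐} [RecFun f]
    [hR : Rec fun v : Fin (n + 1) → 𝔐 => R (fun i => v i.castSucc) (v (Fin.last n))] :
    Rec fun v => Sat {x | R v x} (f v) := by
  have : ∀ {k} (σ : Fin n → Fin k) (j : Fin k), Rec fun v : Fin k → 𝔐 =>
      R (fun i => v (σ i)) (v j) := fun σ j => by
    simpa using hR.reindex (Fin.snoc (α := fun _ => Fin _) σ j)
  have := fun {k} => RecFun.weaken ‹RecFun f› (k := k)
  refine Rec.congr (P := fun w => ∃ n, n ≤ f w ∧ ∃ R', R' ≤ f w ∧ ∃ s, s ≤ f w ∧ ∃ v, v ≤ f w ∧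
    f w = pair (pair n R') s ∧ Elem v R' ∧ ∀ i y, Elem (pair i y) s → (Elem i v ↔ R w y))
    inferInstance fun w => ?_
  constructor
  · rintro ⟨n, R', s, v, h, hv, hs⟩
    have h1 : pair n R' ≤ f w := h ▸ le_pair_left _ _
    have h2 : R' ≤ f w := (le_pair_right _ _).trans h1
    exact ⟨n, (le_pair_left _ _).trans h1, R', h2, s, h ▸ le_pair_right _ _, v,
      hv.lt.le.trans h2, h, hv, hs⟩
  · rintro ⟨n, -, R', -, s, -, v, -, h, hv, hs⟩
    exact ⟨n, R', s, v, h, hv, hs⟩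

end codes

end L2Structure

/-! ### The co-clone case -/

namespace L2Structure

variable {𝔐 : L2Structure.{u}} [h𝔐 : IsModel 𝔐]

theorem Sat.congr {A B : Set 𝔐} {φ : 𝔐} (h : Sat A φ) (hAB : ∀ x, x < φ → (x ∈ A ↔ x ∈ B)) :
    Sat B φ := by
  obtain ⟨n, R, s, v, rfl, hv, hs⟩ := h
  refine ⟨n, R, s, v, rfl, hv, fun i y hy => (hs i y hy).trans (hAB y ?_)⟩
  exact (le_pair_right _ _).trans_lt (hy.lt.trans_le (le_pair_right _ _))

theorem sat_pair {A : Set 𝔐} {n R s : 𝔐} : Sat A (pair (pair n R) s) ↔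
    ∃ v, Elem v R ∧ ∀ i y, Elem (pair i y) s → (Elem i v ↔ y ∈ A) := by
  constructor
  · rintro ⟨n', R', s', v, h, hv, hs⟩
    obtain ⟨h1, h2⟩ := pair_inj.1 h
    obtain ⟨h3, h4⟩ := pair_inj.1 h1
    subst h2 h3 h4
    exact ⟨v, hv, hs⟩
  · rintro ⟨v, hv, hs⟩
    exact ⟨n, R, s, v, rfl, hv, hs⟩

theorem exists_bound {f : 𝔐 → 𝔐} [hf : RecFun fun v : Fin 1 → 𝔐 => f (v 0)] (b : 𝔐) :
    ∃ B, ∀ x, x < b → f x < B := by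
  have : ∀ {k} (i : Fin k), RecFun fun v : Fin k → 𝔐 => f (v i) := fun i => hf.weaken fun _ => i
  refine exists_induction_sig (P := fun b => ∃ B, ∀ x, x < b → f x < B)
    ⟨0, fun x hx => (not_lt_zero' _ hx).elim⟩ ?_ b
  rintro b ⟨B, hB⟩
  refine ⟨max B (f b + 1), fun x hx => ?_⟩
  rcases lt_succ'.1 hx with hx | rfl
  exacts [lt_max_of_lt_left (hB x hx), lt_max_of_lt_right (lt_add_one_iff.2 le_rfl)]

section localization

variable (C L : Set 𝔐) (l₀ t : 𝔐)

/-- The sequence of length `t` with `i`th member `i` if `i ∈ L`, and `l₀` otherwise. -/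
noncomputable def localSeq : 𝔐 :=
  code (pair t (t + l₀) + 1) fun z => ∃ i, i < t ∧ ∃ y, y ≤ t + l₀ ∧ z = pair i y ∧
    ((i ∈ L ∧ y = i) ∨ (i ∉ L ∧ y = l₀))

/-- The projection to the coordinates in `L` of the relation on the variables below `t` that is
defined by the formulas below `t` in `C`. -/
noncomputable def localRel : 𝔐 :=
  code (codeBound t) fun v => IsVec t v ∧ ∃ a, a < codeBound t ∧
    (∀ i, i < t → i ∈ L → (Elem i a ↔ Elem i v)) ∧ ∀ φ, φ < t → φ ∈ C → Sat {x | Elem x a} φ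

/-- A formula with variables in `L` that expresses the satisfiability of the formulas below `t`
in `C`. -/
noncomputable def localFormula : 𝔐 := pair (pair t (localRel C L t)) (localSeq L l₀ t)

/-- The result of replacing the members `y ∉ L` of a sequence by `t + y`. -/
noncomputable def shiftSeq (s : 𝔐) : 𝔐 :=
  code (pair s (t + s) + 1) fun z => ∃ i, i < s ∧ ∃ y, y < s ∧ Elem (pair i y) s ∧
    ((y ∈ L ∧ z = pair i y) ∨ (y ∉ L ∧ z = pair i (t + y)))

variable {C L l₀ t} [IsSet C] [hL : IsSet L]

instance {n : ℕ} {f : (Fin n → 𝔐) → 𝔐} [hf : RecFun f] : RecFun fun v => localSeq L l₀ (f v) :=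
  .comp₁ (F := fun t => localSeq L l₀ t)
    (by unfold localSeq; infer_instance) f

theorem elem_localSeq {i y : 𝔐} : Elem (pair i y) (localSeq L l₀ t) ↔
    i < t ∧ ((i ∈ L ∧ y = i) ∨ (i ∉ L ∧ y = l₀)) := by
  unfold localSeq
  rw [elem_code]
  constructor
  · rintro ⟨-, i', hi', y', -, h, h'⟩
    obtain ⟨rfl, rfl⟩ := pair_inj.1 h
    exact ⟨hi', h'⟩
  · rintro ⟨hi, h⟩
    have hy : y ≤ t + l₀ := by
      rcases h with ⟨-, rfl⟩ | ⟨-, rfl⟩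
      exacts [hi.le.trans le_self_add, le_add_self]
    exact ⟨lt_add_one_iff.2 (pair_le_pair hi.le hy), i, hi, y, hy, rfl, h⟩

theorem isSeq_localSeq : IsSeq t (localSeq L l₀ t) := by
  refine ⟨isCode_code, fun z hz => ?_, fun i hi => ?_⟩
  · obtain ⟨-, i, hi, y, -, h, -⟩ := elem_code.1 hz
    exact ⟨i, y, hi, h⟩
  · simp only [elem_localSeq, hi, true_and]
    by_cases h : i ∈ L
    · exact ⟨i, .inl ⟨h, rfl⟩, by simp [h]⟩
    · exact ⟨l₀, .inr ⟨h, rfl⟩, by simp [h]⟩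

instance {n : ℕ} {f : (Fin n → 𝔐) → 𝔐} [hf : RecFun f] : RecFun fun v => localRel C L (f v) :=
  .comp₁ (F := fun t => localRel C L t) (by unfold localRel; infer_instance) f

theorem isVecSet_localRel : IsVecSet t (localRel C L t) :=
  ⟨isCode_code, fun _ hv => (elem_code.1 hv).2.1⟩

theorem elem_localRel {v : 𝔐} : Elem v (localRel C L t) ↔ IsVec t v ∧ ∃ A ∈ 𝔐.sets,
    (∀ i, i < t → i ∈ L → (i ∈ A ↔ Elem i v)) ∧ ∀ φ, φ < t → φ ∈ C → Sat A φ := by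
  unfold localRel
  rw [elem_code]
  constructor
  · rintro ⟨-, hv, a, -, ha⟩
    exact ⟨hv, {x | Elem x a}, setOf_mem_sets, ha⟩
  · rintro ⟨hv, A, hA, h, h'⟩
    have : IsSet A := ⟨hA⟩
    refine ⟨hv.lt, hv, code t (· ∈ A), code_lt, fun i hi hiL => ?_, fun φ hφ hφC => ?_⟩
    · rw [← h i hi hiL, elem_code, and_iff_right hi]
    · refine (h' φ hφ hφC).congr fun x hx => ?_
      simp [hx.trans hφ]

instance {n : ℕ} {f : (Fin n → 𝔐) → 𝔐} [hf : RecFun f] :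
    RecFun fun v => localFormula C L l₀ (f v) := by
  unfold localFormula; infer_instance

omit [IsSet C] hL in
theorem le_localFormula : t ≤ localFormula C L l₀ t :=
  (le_pair_left _ _).trans (le_pair_left _ _)

theorem sat_localFormula {A : Set 𝔐} [IsSet A] : Sat A (localFormula C L l₀ t) ↔ ∃ A' ∈ 𝔐.sets,
    (∀ i, i < t → i ∈ L → (i ∈ A' ↔ i ∈ A)) ∧ ∀ φ, φ < t → φ ∈ C → Sat A' φ := by
  unfold localFormula
  simp only [sat_pair, elem_localSeq]
  constructor
  · rintro ⟨v, hv, h⟩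
    obtain ⟨-, A', hA', h1, h2⟩ := elem_localRel.1 hv
    exact ⟨A', hA', fun i hi hiL => (h1 i hi hiL).trans (h i i ⟨hi, .inl ⟨hiL, rfl⟩⟩), h2⟩
  · rintro ⟨A', hA', h1, h2⟩
    refine ⟨code t fun i => (i ∈ L ∧ i ∈ A) ∨ (i ∉ L ∧ l₀ ∈ A), elem_localRel.2
      ⟨isVec_code, A', hA', fun i hi hiL => ?_, h2⟩, fun i y ⟨hi, h⟩ => ?_⟩
    · rw [h1 i hi hiL]; simp [hi, hiL]
    · rcases h with ⟨h, rfl⟩ | ⟨h, rfl⟩ <;> simp [h, hi]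

instance {n : ℕ} {f g : (Fin n → 𝔐) → 𝔐} [hf : RecFun f] [hg : RecFun g] :
    RecFun fun v => shiftSeq L (f v) (g v) :=
  .comp₂ (F := fun t s => shiftSeq L t s) (by unfold shiftSeq; infer_instance) f g

theorem elem_shiftSeq {s z : 𝔐} : Elem z (shiftSeq L t s) ↔ ∃ i y, Elem (pair i y) s ∧
    ((y ∈ L ∧ z = pair i y) ∨ (y ∉ L ∧ z = pair i (t + y))) := by
  unfold shiftSeq
  rw [elem_code]
  constructor
  · rintro ⟨-, i, -, y, -, h⟩
    exact ⟨i, y, h⟩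
  · rintro ⟨i, y, h, h'⟩
    have hi : i < s := (le_pair_left _ _).trans_lt h.lt
    have hy : y < s := (le_pair_right _ _).trans_lt h.lt
    refine ⟨lt_add_one_iff.2 ?_, i, hi, y, hy, h, h'⟩
    rcases h' with ⟨-, rfl⟩ | ⟨-, rfl⟩
    · exact pair_le_pair hi.le (hy.le.trans le_add_self)
    · exact pair_le_pair hi.le (add_le_add le_rfl hy.le)

theorem IsSeq.shiftSeq {n s : 𝔐} (hs : IsSeq n s) : IsSeq n (shiftSeq L t s) := by
  refine ⟨isCode_code, fun z hz => ?_, fun i hi => ?_⟩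
  · obtain ⟨i, y, h, h'⟩ := elem_shiftSeq.1 hz
    obtain ⟨i', y', hi', h''⟩ := hs.2.1 _ h
    obtain ⟨rfl, rfl⟩ := pair_inj.1 h''
    rcases h' with ⟨-, rfl⟩ | ⟨-, rfl⟩
    exacts [⟨i, y, hi', rfl⟩, ⟨i, t + y, hi', rfl⟩]
  · obtain ⟨y, hy, huniq⟩ := hs.2.2 i hi
    by_cases hyL : y ∈ L
    · refine ⟨y, elem_shiftSeq.2 ⟨i, y, hy, .inl ⟨hyL, rfl⟩⟩, fun z hz => ?_⟩
      obtain ⟨i', y', h, h'⟩ := elem_shiftSeq.1 hz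
      rcases h' with ⟨h1, h2⟩ | ⟨h1, h2⟩
      · obtain ⟨rfl, rfl⟩ := pair_inj.1 h2
        exact huniq _ h
      · obtain ⟨rfl, -⟩ := pair_inj.1 h2
        exact (h1 (huniq _ h ▸ hyL)).elim
    · refine ⟨t + y, elem_shiftSeq.2 ⟨i, y, hy, .inr ⟨hyL, rfl⟩⟩, fun z hz => ?_⟩
      obtain ⟨i', y', h, h'⟩ := elem_shiftSeq.1 hz
      rcases h' with ⟨h1, h2⟩ | ⟨h1, h2⟩
      · obtain ⟨rfl, -⟩ := pair_inj.1 h2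
        exact (hyL (huniq _ h ▸ h1)).elim
      · obtain ⟨rfl, rfl⟩ := pair_inj.1 h2
        rw [huniq _ h]

theorem sat_shiftSeq {A : Set 𝔐} {n R s : 𝔐} : Sat A (pair (pair n R) (shiftSeq L t s)) ↔
    Sat {y | (y ∈ L ∧ y ∈ A) ∨ (y ∉ L ∧ t + y ∈ A)} (pair (pair n R) s) := by
  simp only [sat_pair, elem_shiftSeq]
  refine exists_congr fun v => and_congr_right fun _ => ?_
  constructor
  · intro h i y hy
    by_cases hyL : y ∈ L
    · simpa [hyL] using h i y ⟨i, y, hy, .inl ⟨hyL, rfl⟩⟩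
    · simpa [hyL] using h i (t + y) ⟨i, y, hy, .inr ⟨hyL, rfl⟩⟩
  · rintro h i z ⟨i', y, hy, h' | h'⟩
    · obtain ⟨rfl, rfl⟩ := pair_inj.1 h'.2
      simpa [h'.1] using h _ _ hy
    · obtain ⟨rfl, rfl⟩ := pair_inj.1 h'.2
      simpa [h'.1] using h _ _ hy

theorem localRel_mem {S V : Set 𝔐} (hS : 𝔐.coClone S ⊆ S) (hC : ∀ φ ∈ C, IsFormula S V φ) :
    pair t (localRel C L t) ∈ S := by
  apply hS
  refine ⟨t, localRel C L t, rfl, isVecSet_localRel,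
    {ψ | ∃ φ, φ < t ∧ φ ∈ C ∧ ∃ r, r ≤ φ ∧ ∃ s, s ≤ φ ∧ φ = pair r s ∧
      ψ = pair r (shiftSeq L t s)}, setOf_mem_sets, ?_, ?_, fun v hv => ?_⟩
  · obtain ⟨B, hB⟩ := exists_bound (f := fun s => shiftSeq L t s) t
    refine ⟨pair t B + 1, ?_⟩
    rintro _ ⟨φ, hφ, -, r, hr, s, hs, -, rfl⟩
    exact lt_add_one_iff.2 (pair_le_pair (hr.trans hφ.le) (hB s (hs.trans_lt hφ)).le)
  · rintro _ ⟨φ, -, hφ, r, -, s, -, h, rfl⟩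
    obtain ⟨n, R, s', h', hR, hs, -⟩ := hC φ hφ
    obtain ⟨rfl, rfl⟩ := pair_inj.1 (h.symm.trans h')
    exact ⟨n, R, _, rfl, .inl hR, hs.shiftSeq, fun _ _ _ => trivial⟩
  · rw [elem_localRel, and_iff_right hv]
    have hpair : ∀ φ ∈ C, ∃ n R s, φ = pair (pair n R) s := fun φ hφ => by
      obtain ⟨n, R, s, h, -⟩ := hC φ hφ
      exact ⟨n, R, s, h⟩
    constructor
    · rintro ⟨A', hA', h, h'⟩
      have : IsSet A' := ⟨hA'⟩
      refine ⟨{x | (x < t ∧ Elem x v) ∨ ∃ y, y ≤ x ∧ x = t + y ∧ y ∈ A'}, setOf_mem_sets,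
        fun i hi => ?_, ?_⟩
      · simp only [Set.mem_ofPred_eq, hi, true_and, or_iff_left_iff_imp]
        rintro ⟨y, -, rfl, -⟩
        exact (hi.not_ge le_self_add).elim
      · rintro _ ⟨φ, hφ, hφC, r, -, s, -, h1, rfl⟩
        obtain ⟨n, R, s', h2⟩ := hpair φ hφC
        obtain ⟨rfl, rfl⟩ := pair_inj.1 (h1.symm.trans h2)
        rw [sat_shiftSeq, ← h1]
        refine (h' φ hφ hφC).congr fun x hx => ?_
        have hx' := hx.trans hφ
        by_cases hxL : x ∈ L
        · have : ¬ ∃ y, y ≤ x ∧ x = t + y ∧ y ∈ A' := by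
            rintro ⟨y, -, rfl, -⟩
            exact hx'.not_ge le_self_add
          simp [hxL, h x hx' hxL, hx', this]
        · simp only [Set.mem_ofPred_eq, hxL, false_and, not_false_eq_true, true_and, false_or]
          constructor
          · exact fun hxA => .inr ⟨x, le_add_self, rfl, hxA⟩
          · rintro (⟨h3, -⟩ | ⟨y, -, h3, h4⟩)
            · exact (h3.not_ge le_self_add).elim
            · rwa [add_left_cancel h3]
    · rintro ⟨A, hA, h, h'⟩
      have : IsSet A := ⟨hA⟩
      refine ⟨{y | (y ∈ L ∧ y ∈ A) ∨ (y ∉ L ∧ t + y ∈ A)}, setOf_mem_sets, fun i hi hiL => ?_,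
        fun φ hφ hφC => ?_⟩
      · simp [hiL, h i hi]
      · obtain ⟨n, R, s, rfl⟩ := hpair φ hφC
        rw [← sat_shiftSeq]
        exact h' _ ⟨_, hφ, hφC, _, le_pair_left _ _, s, le_pair_right _ _, rfl, rfl⟩

end localization

theorem lrsat_of_rsat {S : Set 𝔐} (hS : 𝔐.coClone S ⊆ S) (h : 𝔐.RSAT S) : 𝔐.LRSAT S := by
  intro V _ _ C hCs hC hsat L hLs hLV hLinf
  have : IsSet C := ⟨hCs⟩
  have : IsSet L := ⟨hLs⟩
  obtain ⟨l₀, hl₀⟩ : ∃ l₀, l₀ ∈ L := by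
    by_contra! hne
    exact hLinf ⟨0, fun x hx => (hne x hx).elim⟩
  have h₁ : ∀ φ ∈ {φ | ∃ t, t ≤ φ ∧ φ = localFormula C L l₀ t}, IsFormula S L φ := by
    rintro _ ⟨t, -, rfl⟩
    refine ⟨t, _, _, rfl, localRel_mem hS hC, isSeq_localSeq, fun i y hy => ?_⟩
    rcases (elem_localSeq.1 hy).2 with ⟨hi, rfl⟩ | ⟨-, rfl⟩
    exacts [hi, hl₀]
  have h₂ : 𝔐.FinitelySatisfiable {φ | ∃ t, t ≤ φ ∧ φ = localFormula C L l₀ t} := by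
    rintro F hFs hFC ⟨b, hb⟩
    obtain ⟨A, hA, hAsat⟩ := hsat {φ | φ < b ∧ φ ∈ C} setOf_mem_sets (fun φ hφ => hφ.2)
      ⟨b, fun φ hφ => hφ.1⟩
    have : IsSet A := ⟨hA⟩
    refine ⟨A, hA, fun φ hφ => ?_⟩
    obtain ⟨t, ht, rfl⟩ := hFC hφ
    exact sat_localFormula.2 ⟨A, hA, fun _ _ _ => Iff.rfl, fun ψ hψ hψC =>
      hAsat ψ ⟨hψ.trans_le (ht.trans (hb _ hφ).le), hψC⟩⟩
  obtain ⟨H, hHs, hHL, hHinf, c, hc⟩ := h L hLs hLinf _ setOf_mem_sets h₁ h₂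
  refine ⟨H, hHs, hHL, hHinf, c, fun F hFs hFC ⟨b, hb⟩ => ?_⟩
  obtain ⟨A, hA, hAF, hAH⟩ := hc {φ | φ = localFormula C L l₀ b} setOf_mem_sets
    (by rintro _ rfl; exact ⟨b, le_localFormula, rfl⟩)
    ⟨localFormula C L l₀ b + 1, by rintro _ rfl; exact lt_add_one_iff.2 le_rfl⟩
  have : IsSet A := ⟨hA⟩
  obtain ⟨A', hA', h1, h2⟩ := sat_localFormula.1 (hAF _ rfl)
  have : IsSet A' := ⟨hA'⟩
  refine ⟨{x | (x < b ∧ x ∈ A') ∨ (b ≤ x ∧ x ∈ A)}, setOf_mem_sets, fun φ hφ => ?_,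
    fun a ha => ?_⟩
  · refine (h2 φ (hb φ hφ) (hFC hφ)).congr fun x hx => ?_
    have hxb := hx.trans (hb φ hφ)
    simp [hxb, hxb.not_ge]
  · rw [← hAH a ha]
    rcases lt_or_ge a b with hab | hab
    · simp [hab, hab.not_ge, h1 a hab (hHL ha)]
    · simp [hab, hab.not_gt]

omit h𝔐 in
theorem rsat_of_lrsat {S : Set 𝔐} (h : 𝔐.LRSAT S) : 𝔐.RSAT S :=
  fun V hV hVinf C hC hCS hsat => h V hV hVinf C hC hCS hsat V hV subset_rfl hVinf

end L2Structure

/-! ### Affine and bijunctive relations -/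

namespace L2Structure

variable {𝔐 : L2Structure.{u}} [h𝔐 : IsModel 𝔐]

/-- The set of vectors coded by `R` is closed under the coordinatewise application of the ternary
operation `f`. -/
def Preserves (f : Prop → Prop → Prop → Prop) (n R : 𝔐) : Prop :=
  ∀ v₁ v₂ v₃ v, Elem v₁ R → Elem v₂ R → Elem v₃ R → IsVec n v →
    (∀ i, i < n → (Elem i v ↔ f (Elem i v₁) (Elem i v₂) (Elem i v₃))) → Elem v R

/-- The ternary operation maps sets to sets. -/
class RecOp (𝔐 : L2Structure.{u}) (f : Prop → Prop → Prop → Prop) : Prop where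
  out : ∀ {n : ℕ} (P Q R : (Fin n → 𝔐) → Prop) [Rec P] [Rec Q] [Rec R],
    Rec fun v => f (P v) (Q v) (R v)

attribute [instance] RecOp.out

theorem sat_op {f : Prop → Prop → Prop → Prop} [RecOp 𝔐 f] {n R s : 𝔐}
    (hs : IsSeq n s) (hf : Preserves f n R) {A₁ A₂ A₃ : Set 𝔐} (h₁ : Sat A₁ (pair (pair n R) s))
    (h₂ : Sat A₂ (pair (pair n R) s)) (h₃ : Sat A₃ (pair (pair n R) s)) :
    Sat {x | f (x ∈ A₁) (x ∈ A₂) (x ∈ A₃)} (pair (pair n R) s) := by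
  rw [sat_pair] at h₁ h₂ h₃ ⊢
  obtain ⟨v₁, hv₁, h₁⟩ := h₁
  obtain ⟨v₂, hv₂, h₂⟩ := h₂
  obtain ⟨v₃, hv₃, h₃⟩ := h₃
  refine ⟨code n fun i => f (Elem i v₁) (Elem i v₂) (Elem i v₃),
    hf v₁ v₂ v₃ _ hv₁ hv₂ hv₃ isVec_code fun i hi => by rw [elem_code, and_iff_right hi],
    fun i y hy => ?_⟩
  obtain ⟨i', y', hi, h⟩ := hs.2.1 _ hy
  obtain ⟨rfl, rfl⟩ := pair_inj.1 h
  rw [elem_code, and_iff_right hi, propext (h₁ i y hy), propext (h₂ i y hy), propext (h₃ i y hy)]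
  rfl

theorem preserves_of_eqRel {f : Prop → Prop → Prop → Prop} {n R : 𝔐} (h : pair n R ∈ 𝔐.eqRel) :
    IsVecSet n R ∧ Preserves f n R := by
  obtain ⟨R', h, hR, h'⟩ := h
  obtain ⟨rfl, rfl⟩ := pair_inj.1 h
  refine ⟨hR, fun v₁ v₂ v₃ v h₁ h₂ h₃ hv hf => (h' v hv).2 ?_⟩
  have h01 : (0 : 𝔐) < 1 + 1 := by positivity
  have h11 : (1 : 𝔐) < 1 + 1 := lt_add_one_iff.2 le_rfl
  rw [hf 0 h01, hf 1 h11, propext ((h' v₁ (hR.2 _ h₁)).1 h₁), propext ((h' v₂ (hR.2 _ h₂)).1 h₂),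
    propext ((h' v₃ (hR.2 _ h₃)).1 h₃)]

theorem preserves_of_mem_coClone {f : Prop → Prop → Prop → Prop} [RecOp 𝔐 f] {S : Set 𝔐}
    (hS : ∀ n R, pair n R ∈ S → IsVecSet n R ∧ Preserves f n R) {n R : 𝔐}
    (h : pair n R ∈ 𝔐.coClone S) : Preserves f n R := by
  obtain ⟨n', R', h, hR, F, -, -, hFS, hF⟩ := h
  obtain ⟨rfl, rfl⟩ := pair_inj.1 h
  intro v₁ v₂ v₃ v h₁ h₂ h₃ hv hf
  obtain ⟨A₁, hA₁, hv₁, h₁⟩ := (hF v₁ (hR.2 _ h₁)).1 h₁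
  obtain ⟨A₂, hA₂, hv₂, h₂⟩ := (hF v₂ (hR.2 _ h₂)).1 h₂
  obtain ⟨A₃, hA₃, hv₃, h₃⟩ := (hF v₃ (hR.2 _ h₃)).1 h₃
  have : IsSet A₁ := ⟨hA₁⟩
  have : IsSet A₂ := ⟨hA₂⟩
  have : IsSet A₃ := ⟨hA₃⟩
  refine (hF v hv).2 ⟨{x | f (x ∈ A₁) (x ∈ A₂) (x ∈ A₃)}, setOf_mem_sets, fun i hi => ?_,
    fun φ hφ => ?_⟩
  · rw [hf i hi, ← propext (hv₁ i hi), ← propext (hv₂ i hi), ← propext (hv₃ i hi)]; rfl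
  · obtain ⟨m, Q, s, rfl, hQ, hs, -⟩ := hFS φ hφ
    obtain ⟨-, hQf⟩ : IsVecSet m Q ∧ Preserves f m Q := by
      rcases hQ with hQ | hQ
      exacts [hS m Q hQ, preserves_of_eqRel hQ]
    exact sat_op hs hQf (h₁ _ hφ) (h₂ _ hφ) (h₃ _ hφ)

section bijunctive

/-- The majority operation. -/
def maj (p q r : Prop) : Prop := (p ∧ q) ∨ (p ∧ r) ∨ (q ∧ r)

instance : RecOp 𝔐 maj := ⟨fun _ _ _ _ _ _ => by unfold maj; infer_instance⟩

theorem maj_iff₁₂ {p q r x : Prop} (hp : p ↔ x) (hq : q ↔ x) : maj p q r ↔ x := by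
  unfold maj; tauto

theorem maj_iff₁₃ {p q r x : Prop} (hp : p ↔ x) (hr : r ↔ x) : maj p q r ↔ x := by
  unfold maj; tauto

theorem maj_iff₂₃ {p q r x : Prop} (hq : q ↔ x) (hr : r ↔ x) : maj p q r ↔ x := by
  unfold maj; tauto

/-- The vector coded by `v` satisfies the clause coded by `κ`. -/
def SatClause (v κ : 𝔐) : Prop :=
  ∃ j : 𝔐, (Elem (pair j 1) κ ∧ Elem j v) ∨ (Elem (pair j 0) κ ∧ ¬ Elem j v)

instance {n : ℕ} {f g : (Fin n → 𝔐) → 𝔐} [RecFun f] [RecFun g] :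
    Rec fun v => SatClause (f v) (g v) := by
  refine Rec.comp₂ (Rec.congr (P := fun v => ∃ j, j < v 1 ∧ ((Elem (pair j 1) (v 1) ∧
    Elem j (v 0)) ∨ (Elem (pair j 0) (v 1) ∧ ¬ Elem j (v 0)))) inferInstance fun v => ?_) f g
  refine ⟨fun ⟨j, h⟩ => ⟨j, ?_, h⟩, fun ⟨j, _, h⟩ => ⟨j, h⟩⟩
  rcases h with h | h <;> exact (le_pair_left _ _).trans_lt h.1.lt

theorem pair_one_ne_pair_zero {a b : 𝔐} : pair a 1 ≠ pair b 0 := fun h =>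
  one_ne_zero (pair_inj.1 h).2

theorem preserves_of_bijunctive {n R : 𝔐} (h : pair n R ∈ 𝔐.bijunctiveRels) :
    IsVecSet n R ∧ Preserves maj n R := by
  obtain ⟨n', R', h, hR, E, -, -, hE, hRE⟩ := h
  obtain ⟨rfl, rfl⟩ := pair_inj.1 h
  refine ⟨hR, fun v₁ v₂ v₃ v h₁ h₂ h₃ hv hf => (hRE v hv).2 fun κ hκ => ?_⟩
  obtain ⟨hκn, l₁, l₂, hl⟩ := hE κ hκ
  have lit : ∀ w, Elem w R → ∃ l, (l = l₁ ∨ l = l₂) ∧ ∃ j, j < n ∧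
      ((l = pair j 1 ∧ Elem l κ ∧ Elem j w) ∨ (l = pair j 0 ∧ Elem l κ ∧ ¬ Elem j w)) := by
    intro w hw
    have key : ∀ j l, Elem l κ → (l = pair j 0 ∨ l = pair j 1) → j < n := by
      intro j l hlκ hlj
      obtain ⟨j', hj', h'⟩ := hκn l hlκ
      have : j = j' := by
        rcases hlj with rfl | rfl <;> rcases h' with h' | h' <;> exact (pair_inj.1 h').1
      rwa [this]
    obtain ⟨j, ⟨h1, h2⟩ | ⟨h1, h2⟩⟩ := (hRE w (hR.2 w hw)).1 hw κ hκ
    · exact ⟨_, hl _ h1, j, key j _ h1 (.inr rfl), .inl ⟨rfl, h1, h2⟩⟩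
    · exact ⟨_, hl _ h1, j, key j _ h1 (.inl rfl), .inr ⟨rfl, h1, h2⟩⟩
  have two : ∀ (w w' : 𝔐), (∀ i, i < n → (Elem i w ↔ Elem i w') → (Elem i v ↔ Elem i w)) →
      ∀ l, (∃ j, j < n ∧
        ((l = pair j 1 ∧ Elem l κ ∧ Elem j w) ∨ (l = pair j 0 ∧ Elem l κ ∧ ¬ Elem j w))) →
      (∃ j, j < n ∧
        ((l = pair j 1 ∧ Elem l κ ∧ Elem j w') ∨ (l = pair j 0 ∧ Elem l κ ∧ ¬ Elem j w'))) →
      ∃ j, (Elem (pair j 1) κ ∧ Elem j v) ∨ (Elem (pair j 0) κ ∧ ¬ Elem j v) := by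
    rintro w w' hww' l ⟨j, hj, h⟩ ⟨j', -, h'⟩
    refine ⟨j, ?_⟩
    rcases h with ⟨rfl, h2, h3⟩ | ⟨rfl, h2, h3⟩
    · rcases h' with ⟨h1', -, h3'⟩ | ⟨h1', -, h3'⟩
      · obtain ⟨rfl, -⟩ := pair_inj.1 h1'
        exact .inl ⟨h2, (hww' j hj (iff_of_true h3 h3')).2 h3⟩
      · exact (pair_one_ne_pair_zero h1').elim
    · rcases h' with ⟨h1', -, h3'⟩ | ⟨h1', -, h3'⟩
      · exact (pair_one_ne_pair_zero h1'.symm).elim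
      · obtain ⟨rfl, -⟩ := pair_inj.1 h1'
        exact .inr ⟨h2, fun h => h3 ((hww' j hj (iff_of_false h3 h3')).1 h)⟩
  obtain ⟨a₁, ha₁, h₁⟩ := lit v₁ h₁
  obtain ⟨a₂, ha₂, h₂⟩ := lit v₂ h₂
  obtain ⟨a₃, ha₃, h₃⟩ := lit v₃ h₃
  have two12 := two v₁ v₂ fun i hi h => (hf i hi).trans (maj_iff₁₂ Iff.rfl h.symm)
  have two13 := two v₁ v₃ fun i hi h => (hf i hi).trans (maj_iff₁₃ Iff.rfl h.symm)
  have two23 := two v₂ v₃ fun i hi h => (hf i hi).trans (maj_iff₂₃ Iff.rfl h.symm)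
  rcases ha₁ with rfl | rfl <;> rcases ha₂ with rfl | rfl
  · exact two12 _ h₁ h₂
  · rcases ha₃ with rfl | rfl
    exacts [two13 _ h₁ h₃, two23 _ h₂ h₃]
  · rcases ha₃ with rfl | rfl
    exacts [two23 _ h₂ h₃, two13 _ h₁ h₃]
  · exact two12 _ h₁ h₂

theorem mem_of_forall_exists_agree {n R v : 𝔐} (hR : IsVecSet n R) (hf : Preserves maj n R)
    (hv : IsVec n v) (hne : ∃ u, Elem u R)
    (h : ∀ i, i < n → ∀ j, j < n → ∃ u, Elem u R ∧ (Elem i u ↔ Elem i v) ∧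
      (Elem j u ↔ Elem j v)) : Elem v R := by
  have key : ∀ k, ∀ i, i < n → ∀ j, j < n → ∃ u, Elem u R ∧ (Elem i u ↔ Elem i v) ∧
      (Elem j u ↔ Elem j v) ∧ ∀ l, l < k → (Elem l u ↔ Elem l v) := by
    refine exists_induction_sig (P := fun k => ∀ i, i < n → ∀ j, j < n → ∃ u, Elem u R ∧
      (Elem i u ↔ Elem i v) ∧ (Elem j u ↔ Elem j v) ∧ ∀ l, l < k → (Elem l u ↔ Elem l v))
      (fun i hi j hj => ?_) fun k ih i hi j hj => ?_
    · obtain ⟨u, h1, h2, h3⟩ := h i hi j hj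
      exact ⟨u, h1, h2, h3, fun l hl => (not_lt_zero' _ hl).elim⟩
    · rcases lt_or_ge k n with hk | hk
      · obtain ⟨u₁, hu₁, h1i, h1k, h1⟩ := ih i hi k hk
        obtain ⟨u₂, hu₂, h2j, h2k, h2⟩ := ih j hj k hk
        obtain ⟨u₃, hu₃, h3i, h3j, h3⟩ := ih i hi j hj
        have hc : ∀ l, l < n → (Elem l (code n fun i => maj (Elem i u₁) (Elem i u₂) (Elem i u₃)) ↔
            maj (Elem l u₁) (Elem l u₂) (Elem l u₃)) := fun l hl => by
          rw [elem_code, and_iff_right hl]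
        refine ⟨_, hf u₁ u₂ u₃ _ hu₁ hu₂ hu₃ isVec_code hc, ?_, ?_, fun l hl => ?_⟩
        · exact (hc i hi).trans (maj_iff₁₃ h1i h3i)
        · exact (hc j hj).trans (maj_iff₂₃ h2j h3j)
        · rcases lt_succ'.1 hl with hl | rfl
          · exact (hc l (hl.trans hk)).trans (maj_iff₁₂ (h1 l hl) (h2 l hl))
          · exact (hc l hk).trans (maj_iff₁₂ h1k h2k)
      · obtain ⟨u, hu, h1, h2, h3⟩ := ih i hi j hj
        refine ⟨u, hu, h1, h2, fun l _ => ?_⟩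
        rcases lt_or_ge l n with hl | hl
        · exact h3 l (hl.trans_le hk)
        · exact iff_of_false (fun h => hl.not_gt ((hR.2 u hu).2 l h)) fun h => hl.not_gt (hv.2 l h)
  have ex : ∃ u, Elem u R ∧ ∀ l, l < n → (Elem l u ↔ Elem l v) := by
    rcases eq_or_ne n 0 with rfl | hn
    · obtain ⟨u, hu⟩ := hne
      exact ⟨u, hu, fun l hl => (not_lt_zero' _ hl).elim⟩
    · obtain ⟨u, hu, -, -, h⟩ := key n 0 (pos_of_ne_zero hn) 0 (pos_of_ne_zero hn)
      exact ⟨u, hu, h⟩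
  obtain ⟨u, hu, h⟩ := ex
  rwa [← (hR.2 u hu).ext hv h]

theorem bijunctive_of_preserves {n R : 𝔐} (hR : IsVecSet n R) (hf : Preserves maj n R) :
    pair n R ∈ 𝔐.bijunctiveRels := by
  refine ⟨n, R, rfl, hR, {κ | κ < codeBound (pair n 1 + 1) ∧
    (∀ l, Elem l κ → ∃ j, j < n ∧ (l = pair j 0 ∨ l = pair j 1)) ∧
    (∃ l₁, l₁ < pair n 1 + 1 ∧ ∃ l₂, l₂ < pair n 1 + 1 ∧ ∀ l, Elem l κ → l = l₁ ∨ l = l₂) ∧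
    ∀ v, Elem v R → SatClause v κ}, setOf_mem_sets, ⟨_, fun κ hκ => hκ.1⟩,
    fun κ hκ => ⟨hκ.2.1, ?_⟩, fun v hv => ⟨fun h κ hκ => hκ.2.2.2 v h, fun h => ?_⟩⟩
  · obtain ⟨l₁, -, l₂, -, h⟩ := hκ.2.2.1
    exact ⟨l₁, l₂, h⟩
  have main : ∀ l₁ l₂ : 𝔐, (∃ j, j < n ∧ (l₁ = pair j 0 ∨ l₁ = pair j 1)) →
      (∃ j, j < n ∧ (l₂ = pair j 0 ∨ l₂ = pair j 1)) →
      (∀ u, Elem u R → ∃ j, ((pair j 1 = l₁ ∨ pair j 1 = l₂) ∧ Elem j u) ∨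
        ((pair j 0 = l₁ ∨ pair j 0 = l₂) ∧ ¬ Elem j u)) →
      ∃ j, ((pair j 1 = l₁ ∨ pair j 1 = l₂) ∧ Elem j v) ∨
        ((pair j 0 = l₁ ∨ pair j 0 = l₂) ∧ ¬ Elem j v) := by
    intro l₁ l₂ h₁ h₂ hu
    have hlt : ∀ l, (∃ j, j < n ∧ (l = pair j 0 ∨ l = pair j 1)) → l < pair n 1 + 1 := by
      rintro l ⟨j, hj, rfl | rfl⟩
      exacts [lt_add_one_iff.2 (pair_le_pair hj.le zero_le),
        lt_add_one_iff.2 (pair_le_pair hj.le le_rfl)]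
    have hc : ∀ l, Elem l (code (pair n 1 + 1) fun l => l = l₁ ∨ l = l₂) ↔ l = l₁ ∨ l = l₂ := by
      intro l
      rw [elem_code, and_iff_right_iff_imp]
      rintro (rfl | rfl)
      exacts [hlt _ h₁, hlt _ h₂]
    have := h (code (pair n 1 + 1) fun l => l = l₁ ∨ l = l₂) ⟨code_lt, fun l hl => ?_,
      ⟨l₁, hlt _ h₁, l₂, hlt _ h₂, fun l hl => (hc l).1 hl⟩, fun u huR => ?_⟩
    · simpa only [hc] using this
    · rcases (hc l).1 hl with rfl | rfl
      exacts [h₁, h₂]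
    · simpa only [SatClause, hc] using hu u huR
  refine mem_of_forall_exists_agree hR hf hv ?_ fun i hi j hj => ?_
  · by_contra! hne
    obtain ⟨j, h'⟩ := h (code (pair n 1 + 1) fun _ => False)
      ⟨code_lt, by simp, ⟨0, by positivity, 0, by positivity, by simp⟩, fun u hu => (hne u hu).elim⟩
    simp at h'
  · by_contra! hne
    classical
    have hlit : ∀ i, i < n → ∃ l : 𝔐, (∃ j, j < n ∧ (l = pair j 0 ∨ l = pair j 1)) ∧
        (∀ j, pair j 1 = l ↔ j = i ∧ ¬ Elem i v) ∧ (∀ j, pair j 0 = l ↔ j = i ∧ Elem i v) := by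
      intro i hi
      by_cases hiv : Elem i v
      · refine ⟨pair i 0, ⟨i, hi, .inl rfl⟩, fun j => ?_, fun j => ?_⟩ <;> simp [pair_inj, hiv]
      · refine ⟨pair i 1, ⟨i, hi, .inr rfl⟩, fun j => ?_, fun j => ?_⟩ <;> simp [pair_inj, hiv]
    obtain ⟨l₁, h₁, h₁1, h₁0⟩ := hlit i hi
    obtain ⟨l₂, h₂, h₂1, h₂0⟩ := hlit j hj
    have := main l₁ l₂ h₁ h₂ fun u hu => ?_
    · obtain ⟨j', h'⟩ := this
      simp only [h₁1, h₂1, h₁0, h₂0] at h'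
      rcases h' with ⟨⟨rfl, h⟩ | ⟨rfl, h⟩, h'⟩ | ⟨⟨rfl, h⟩ | ⟨rfl, h⟩, h'⟩ <;> contradiction
    · simp only [h₁1, h₂1, h₁0, h₂0]
      have key : ∀ i, ¬ (Elem i u ↔ Elem i v) → (¬ Elem i v ∧ Elem i u) ∨ (Elem i v ∧ ¬ Elem i u) :=
        fun i h => by tauto
      by_cases hiu : Elem i u ↔ Elem i v
      · refine ⟨j, (key j fun h => ?_).imp (fun h => ⟨.inr ⟨rfl, h.1⟩, h.2⟩)
          fun h => ⟨.inr ⟨rfl, h.1⟩, h.2⟩⟩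
        rcases hne u hu hiu with h' | h'
        exacts [h'.2 (h.1 h'.1), h'.1 (h.2 h'.2)]
      · exact ⟨i, (key i hiu).imp (fun h => ⟨.inl ⟨rfl, h.1⟩, h.2⟩)
          fun h => ⟨.inl ⟨rfl, h.1⟩, h.2⟩⟩

theorem coClone_bijunctiveRels : 𝔐.coClone 𝔐.bijunctiveRels ⊆ 𝔐.bijunctiveRels := by
  rintro r hr
  obtain ⟨n, R, rfl, hR, -⟩ := id hr
  exact bijunctive_of_preserves hR
    (preserves_of_mem_coClone (fun _ _ => preserves_of_bijunctive) hr)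

end bijunctive

end L2Structure

namespace L2Structure

variable {𝔐 : L2Structure.{u}} [h𝔐 : IsModel 𝔐]

section parity

theorem exists_parity (P : 𝔐 → Prop) [hP : Rec fun v : Fin 1 → 𝔐 => P (v 0)] (n : 𝔐) :
    ∃ c : 𝔐, ¬ Elem 0 c ∧ ∀ j, j < n → (Elem (j + 1) c ↔ ¬ (Elem j c ↔ P j)) := by
  have : ∀ {k} (i : Fin k), Rec fun v : Fin k → 𝔐 => P (v i) := fun i => hP.reindex fun _ => i
  refine exists_induction_sig (P := fun n => ∃ c : 𝔐, ¬ Elem 0 c ∧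
    ∀ j, j < n → (Elem (j + 1) c ↔ ¬ (Elem j c ↔ P j)))
    ⟨0, fun h => not_lt_zero' _ h.lt, fun j hj => (not_lt_zero' _ hj).elim⟩ ?_ n
  rintro n ⟨c, h0, hc⟩
  have key : ∀ i, Elem i (code (n + 1 + 1) fun i => (i ≤ n ∧ Elem i c) ∨
      (i = n + 1 ∧ ¬ (Elem n c ↔ P n))) ↔ (i ≤ n ∧ Elem i c) ∨
      (i = n + 1 ∧ ¬ (Elem n c ↔ P n)) := fun i => by
    rw [elem_code, and_iff_right_iff_imp]
    rintro (h | h)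
    exacts [lt_add_one_iff.2 (h.1.trans le_self_add), lt_add_one_iff.2 h.1.le]
  have hn1 : ¬ n + 1 ≤ n := not_le.2 (lt_add_one_iff.2 le_rfl)
  have hle : ∀ i, i ≤ n → (Elem i (code (n + 1 + 1) fun i => (i ≤ n ∧ Elem i c) ∨
      (i = n + 1 ∧ ¬ (Elem n c ↔ P n))) ↔ Elem i c) := fun i hi => by
    rw [key, and_iff_right hi, or_iff_left]
    rintro ⟨rfl, -⟩
    exact hn1 hi
  refine ⟨_, (hle 0 zero_le).not.2 h0, fun j hj => ?_⟩
  rw [hle j (lt_add_one_iff.1 hj)]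
  rcases lt_succ'.1 hj with hj | rfl
  · rw [hle (j + 1) (succ_le_iff'.2 hj), hc j hj]
  · rw [key]
    simp [hn1]

theorem isOdd_iff {X P : Set 𝔐} [IsSet X] [IsSet P] {n : 𝔐} (h0 : 0 ∉ P)
    (h : ∀ j, j < n → (j + 1 ∈ P ↔ ¬ (j ∈ P ↔ j ∈ X))) : 𝔐.IsOdd n X ↔ n ∈ P := by
  refine ⟨fun ⟨Q, hQ, hQ0, hQX, hQn⟩ => ?_, fun hn => ⟨P, IsSet.mem_sets, h0, h, hn⟩⟩
  have : IsSet Q := ⟨hQ⟩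
  have key := exists_induction_sig (P := fun j => j ≤ n → (j ∈ P ↔ j ∈ Q))
    (fun _ => iff_of_false h0 hQ0) (fun j ih hj => by
      have hjn := succ_le_iff'.1 hj
      rw [h j hjn, hQX j hjn, ih hjn.le]) n le_rfl
  exact key.2 hQn

omit h𝔐 in
theorem isOdd_congr {X Y : Set 𝔐} {n : 𝔐} (h : ∀ j, j < n → (j ∈ X ↔ j ∈ Y)) :
    𝔐.IsOdd n X ↔ 𝔐.IsOdd n Y := by
  unfold IsOdd
  refine exists_congr fun P => and_congr_right fun _ => and_congr_right fun _ =>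
    and_congr_left fun _ => forall₂_congr fun j hj => ?_
  rw [h j hj]

theorem isOdd_xor (P Q : 𝔐 → Prop) [Rec fun v : Fin 1 → 𝔐 => P (v 0)]
    [Rec fun v : Fin 1 → 𝔐 => Q (v 0)] (n : 𝔐) :
    𝔐.IsOdd n {j | ¬ (P j ↔ Q j)} ↔ ¬ (𝔐.IsOdd n {j | P j} ↔ 𝔐.IsOdd n {j | Q j}) := by
  obtain ⟨c, hc0, hc⟩ := exists_parity P n
  obtain ⟨d, hd0, hd⟩ := exists_parity Q n
  rw [isOdd_iff (X := {j | P j}) (P := {j | Elem j c}) hc0 hc,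
    isOdd_iff (X := {j | Q j}) (P := {j | Elem j d}) hd0 hd,
    isOdd_iff (X := {j | ¬ (P j ↔ Q j)}) (P := {j | ¬ (Elem j c ↔ Elem j d)})
      (by simp [hc0, hd0]) fun j hj => ?_]
  · rfl
  · simp only [Set.mem_ofPred_eq, hc j hj, hd j hj]
    tauto

/-- The number of `j < n` that belong to both of the sets coded by `D` and `v` is odd. -/
def OddOn (n D v : 𝔐) : Prop := 𝔐.IsOdd n {j | Elem j D ∧ Elem j v}

instance {k : ℕ} {f g h : (Fin k → 𝔐) → 𝔐} [RecFun f] [RecFun g] [RecFun h] :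
    Rec fun v => OddOn (f v) (g v) (h v) := by
  have key : ∀ n D v : 𝔐, ∃ c : 𝔐, (¬ Elem 0 c ∧
      ∀ j, j < n → (Elem (j + 1) c ↔ ¬ (Elem j c ↔ (Elem j D ∧ Elem j v)))) := fun n D v =>
    exists_parity (fun j => Elem j D ∧ Elem j v) n
  have key' : ∀ n D v c : 𝔐, (¬ Elem 0 c ∧
      ∀ j, j < n → (Elem (j + 1) c ↔ ¬ (Elem j c ↔ (Elem j D ∧ Elem j v)))) →
      (OddOn n D v ↔ Elem n c) := fun n D v c h =>
    isOdd_iff (X := {j | Elem j D ∧ Elem j v}) (P := {j | Elem j c}) h.1 h.2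
  refine Rec.comp₃ ⟨?_, ?_⟩ f g h
  · refine Sig.congr (P := fun w : Fin 3 → 𝔐 => ∃ c : 𝔐, (¬ Elem 0 c ∧ ∀ j, j < w 0 →
      (Elem (j + 1) c ↔ ¬ (Elem j c ↔ (Elem j (w 1) ∧ Elem j (w 2))))) ∧ Elem (w 0) c)
      inferInstance fun w => ?_
    constructor
    · intro ho
      obtain ⟨c, hc⟩ := key (w 0) (w 1) (w 2)
      exact ⟨c, hc, (key' _ _ _ _ hc).1 ho⟩
    · rintro ⟨c, hc, hw⟩
      exact (key' _ _ _ _ hc).2 hw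
  · refine Sig.congr (P := fun w : Fin 3 → 𝔐 => ∃ c : 𝔐, (¬ Elem 0 c ∧ ∀ j, j < w 0 →
      (Elem (j + 1) c ↔ ¬ (Elem j c ↔ (Elem j (w 1) ∧ Elem j (w 2))))) ∧ ¬ Elem (w 0) c)
      inferInstance fun w => ?_
    constructor
    · intro ho
      obtain ⟨c, hc⟩ := key (w 0) (w 1) (w 2)
      exact ⟨c, hc, fun hw => ho ((key' _ _ _ _ hc).2 hw)⟩
    · rintro ⟨c, hc, hw⟩ ho
      exact hw ((key' _ _ _ _ hc).1 ho)

theorem oddOn_xor_left {n D D' E v : 𝔐}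
    (h : ∀ j, j < n → (Elem j E ↔ ¬ (Elem j D ↔ Elem j D'))) :
    OddOn n E v ↔ ¬ (OddOn n D v ↔ OddOn n D' v) := by
  unfold OddOn
  rw [← isOdd_xor]
  refine isOdd_congr fun j hj => ?_
  simp only [Set.mem_ofPred_eq, h j hj]
  tauto

theorem oddOn_xor_right {n D v v' w : 𝔐}
    (h : ∀ j, j < n → (Elem j w ↔ ¬ (Elem j v ↔ Elem j v'))) :
    OddOn n D w ↔ ¬ (OddOn n D v ↔ OddOn n D v') := by
  unfold OddOn
  rw [← isOdd_xor]
  refine isOdd_congr fun j hj => ?_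
  simp only [Set.mem_ofPred_eq, h j hj]
  tauto

theorem not_oddOn {n D v : 𝔐} (h : ∀ j, j < n → ¬ (Elem j D ∧ Elem j v)) : ¬ OddOn n D v := by
  unfold OddOn
  rw [isOdd_iff (P := {_j | False}) (by simp) fun j hj => by simpa using h j hj]
  simp

theorem oddOn_iff_of_unique {n k D v : 𝔐} (hk : k < n)
    (h : ∀ j, j < n → ((Elem j D ∧ Elem j v) ↔ (j = k ∧ Elem k v))) :
    OddOn n D v ↔ Elem k v := by
  unfold OddOn
  rw [isOdd_iff (P := {j | k < j ∧ Elem k v}) (fun h => not_lt_zero' _ h.1) fun j hj => ?_]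
  · simp [hk]
  · simp only [Set.mem_ofPred_eq, h j hj]
    rw [lt_add_one_iff]
    rcases lt_trichotomy k j with h' | rfl | h'
    · simp [h', h'.le, h'.ne']
    · simp
    · simp [h'.not_ge, h'.not_gt, h'.ne]

end parity

section affine

/-- The sum of three bits. -/
def xor₃ (p q r : Prop) : Prop := ((p ↔ q) ↔ r)

instance : RecOp 𝔐 xor₃ := ⟨fun _ _ _ _ _ _ => by unfold xor₃; infer_instance⟩

theorem xor₃_of_iff {p q r : Prop} (h : q ↔ r) : xor₃ p q r ↔ p := by
  unfold xor₃; tauto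

theorem xor₃_of_not_iff {p q r : Prop} (h : ¬ (q ↔ r)) : xor₃ p q r ↔ ¬ p := by
  unfold xor₃; tauto

theorem iff_of_not_xor_iff {p p' q q' : Prop} (h : ¬ (¬ (p ↔ q) ↔ ¬ (p' ↔ q')))
    (hq : ¬ (q ↔ q')) : p ↔ p' := by
  tauto

theorem not_iff_of_not_xor_iff {p p' q q' : Prop} (h : ¬ (¬ (p ↔ q) ↔ ¬ (p' ↔ q')))
    (hq : q ↔ q') : ¬ (p ↔ p') := by
  tauto

theorem oddOn_xor₃ {n D v₁ v₂ v₃ v : 𝔐}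
    (h : ∀ i, i < n → (Elem i v ↔ xor₃ (Elem i v₁) (Elem i v₂) (Elem i v₃))) :
    OddOn n D v ↔ xor₃ (OddOn n D v₁) (OddOn n D v₂) (OddOn n D v₃) := by
  have h₁ : ∀ i, i < n → (Elem i (code n fun i => ¬ (Elem i v₁ ↔ Elem i v₂)) ↔
      ¬ (Elem i v₁ ↔ Elem i v₂)) := fun i hi => by rw [elem_code, and_iff_right hi]
  rw [oddOn_xor_right (v' := v₃) fun j hj => (h j hj).trans ?_, oddOn_xor_right h₁]
  · unfold xor₃; tauto
  · rw [h₁ j hj]; unfold xor₃; tauto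

theorem preserves_of_affine {n R : 𝔐} (h : pair n R ∈ 𝔐.affineRels) :
    IsVecSet n R ∧ Preserves xor₃ n R := by
  obtain ⟨n', R', h, hR, E, -, -, -, hRE⟩ := h
  obtain ⟨rfl, rfl⟩ := pair_inj.1 h
  refine ⟨hR, fun v₁ v₂ v₃ v h₁ h₂ h₃ hv hf => (hRE v hv).2 fun D i hi => ?_⟩
  refine (oddOn_xor₃ hf).trans ?_
  have e₁ := (hRE v₁ (hR.2 _ h₁)).1 h₁ D i hi
  have e₂ := (hRE v₂ (hR.2 _ h₂)).1 h₂ D i hi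
  have e₃ := (hRE v₃ (hR.2 _ h₃)).1 h₃ D i hi
  change OddOn n D v₁ ↔ _ at e₁
  change OddOn n D v₂ ↔ _ at e₂
  change OddOn n D v₃ ↔ _ at e₃
  rw [e₁, e₂, e₃]
  unfold xor₃; tauto

variable {n R : 𝔐}

theorem exists_equation (hf : Preserves xor₃ n R) {k : 𝔐} (hk : k < n)
    (hdet : ∀ w w', Elem w R → Elem w' R → (∀ j, j < k → (Elem j w ↔ Elem j w')) →
      (Elem k w ↔ Elem k w')) :
    ∃ D, IsVec n D ∧ Elem k D ∧ (∀ j, Elem j D → j ≤ k) ∧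
      ∀ w w', Elem w R → Elem w' R → (OddOn n D w ↔ OddOn n D w') := by
  by_contra! hneg
  have key : ∀ m, m ≤ k → ∀ D, D < codeBound n → IsVec n D → Elem k D →
      (∀ j, Elem j D → j ≤ k) → ∃ w, Elem w R ∧ ∃ w', Elem w' R ∧
        (∀ j, j < m → (Elem j w ↔ Elem j w')) ∧ ¬ (OddOn n D w ↔ OddOn n D w') := by
    refine exists_induction_sig (P := fun m => m ≤ k → ∀ D, D < codeBound n → IsVec n D →
      Elem k D → (∀ j, Elem j D → j ≤ k) → ∃ w, Elem w R ∧ ∃ w', Elem w' R ∧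
        (∀ j, j < m → (Elem j w ↔ Elem j w')) ∧ ¬ (OddOn n D w ↔ OddOn n D w')) ?_ ?_
    · intro _ D _ hD hkD hDk
      obtain ⟨w, w', hw, hw', h⟩ := hneg D hD hkD hDk
      refine ⟨w, hw, w', hw', fun j hj => (not_lt_zero' _ hj).elim, fun h' => ?_⟩
      rcases h with h | h
      exacts [h.2 (h'.1 h.1), h.1 (h'.2 h.2)]
    · intro m ih hm D hDlt hD hkD hDk
      have hmk := succ_le_iff'.1 hm
      have hmn := hmk.trans hk
      have ih := ih hmk.le
      obtain ⟨w, hw, w', hw', hagree, hne⟩ := ih D hDlt hD hkD hDk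
      have succ : ∀ {x y : 𝔐}, (∀ j, j < m → (Elem j x ↔ Elem j y)) → (Elem m x ↔ Elem m y) →
          ∀ j, j < m + 1 → (Elem j x ↔ Elem j y) := fun h h' j hj => by
        rcases lt_succ'.1 hj with hj | rfl
        exacts [h j hj, h']
      by_cases hm_w : Elem m w ↔ Elem m w'
      · exact ⟨w, hw, w', hw', succ hagree hm_w, hne⟩
      have hsing : ∀ j, j < n → (Elem j (code n fun j => j = m) ↔ j = m) := fun j hj => by
        rw [elem_code, and_iff_right hj]
      have hD' : ∀ j, j < n → (Elem j (code n fun j => ¬ (Elem j D ↔ j = m)) ↔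
          ¬ (Elem j D ↔ Elem j (code n fun j => j = m))) := fun j hj => by
        rw [elem_code, and_iff_right hj, hsing j hj]
      obtain ⟨z, hz, z', hz', hzagree, hzne⟩ := ih (code n fun j => ¬ (Elem j D ↔ j = m))
        code_lt isVec_code (by simp [hk, hkD, hmk.ne']) fun j hj => by
          rw [elem_code] at hj
          by_contra! hkj
          exact hj.2 (iff_of_false (fun h => hkj.not_ge (hDk j h)) (hmk.trans hkj).ne')
      have hm_odd : ∀ x, OddOn n (code n fun j => j = m) x ↔ Elem m x := fun x =>
        oddOn_iff_of_unique hmn fun j hj => by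
          rw [hsing j hj]
          exact and_congr_right fun h => by rw [h]
      rw [oddOn_xor_left hD', oddOn_xor_left hD', hm_odd, hm_odd] at hzne
      by_cases hm_z : Elem m z ↔ Elem m z'
      · refine ⟨z, hz, z', hz', succ hzagree hm_z, not_iff_of_not_xor_iff hzne hm_z⟩
      · have hc : ∀ i, i < n → (Elem i (code n fun i => xor₃ (Elem i z) (Elem i w) (Elem i w')) ↔
            xor₃ (Elem i z) (Elem i w) (Elem i w')) := fun i hi => by
          rw [elem_code, and_iff_right hi]
        refine ⟨_, hf z w w' _ hz hw hw' isVec_code hc, z', hz', succ (fun j hj => ?_) ?_, ?_⟩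
        · rw [hc j (hj.trans hmn), xor₃_of_iff (hagree j hj), hzagree j hj]
        · rw [hc m hmn, xor₃_of_not_iff hm_w]
          exact not_iff.1 hm_z
        · rw [oddOn_xor₃ hc, xor₃_of_not_iff hne, iff_of_not_xor_iff hzne hm_z]
          exact not_iff_self
  have hsing : ∀ j, j < n → (Elem j (code n fun j => j = k) ↔ j = k) := fun j hj => by
    rw [elem_code, and_iff_right hj]
  obtain ⟨w, hw, w', hw', hagree, hne⟩ := key k le_rfl (code n fun j => j = k) code_lt isVec_code
    ((hsing k hk).2 rfl) fun j hj => ((elem_code.1 hj).2).le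
  have hk_odd : ∀ x, OddOn n (code n fun j => j = k) x ↔ Elem k x := fun x =>
    oddOn_iff_of_unique hk fun j hj => by
      rw [hsing j hj]
      exact and_congr_right fun h => by rw [h]
  rw [hk_odd, hk_odd] at hne
  exact hne (hdet w w' hw hw' hagree)

theorem mem_of_forall_equation (hR : IsVecSet n R) (hf : Preserves xor₃ n R) {v : 𝔐}
    (hv : IsVec n v)
    (h : ∀ D, IsVec n D → ∀ p : Prop, (∀ u, Elem u R → (OddOn n D u ↔ p)) → (OddOn n D v ↔ p)) :
    Elem v R := by
  have key : ∀ k, k ≤ n → ∃ u, Elem u R ∧ ∀ j, j < k → (Elem j u ↔ Elem j v) := by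
    refine exists_induction_sig
      (P := fun k => k ≤ n → ∃ u, Elem u R ∧ ∀ j, j < k → (Elem j u ↔ Elem j v)) ?_ ?_
    · intro _
      by_contra! hne
      have := (h (code n fun _ => False) isVec_code True fun u hu => by
        obtain ⟨j, hj, -⟩ := hne u hu
        exact (not_lt_zero' _ hj).elim).2 trivial
      exact not_oddOn (by simp) this
    · intro k ih hkn
      have hk := succ_le_iff'.1 hkn
      obtain ⟨u, hu, hagree⟩ := ih hk.le
      by_cases hdet : ∀ w w', Elem w R → Elem w' R → (∀ j, j < k → (Elem j w ↔ Elem j w')) →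
          (Elem k w ↔ Elem k w')
      · obtain ⟨D, hD, hkD, hDk, hconst⟩ := exists_equation hf hk hdet
        have huv : OddOn n D v ↔ OddOn n D u := h D hD _ fun u' hu' => hconst u' u hu' hu
        have hc : ∀ j, j < n → (Elem j (code n fun j => ¬ (Elem j v ↔ Elem j u)) ↔
            ¬ (Elem j v ↔ Elem j u)) := fun j hj => by rw [elem_code, and_iff_right hj]
        have hodd := (oddOn_xor_right (D := D) hc).not.2 (not_not.2 huv)
        rw [oddOn_iff_of_unique hk, hc k hk, not_not] at hodd
        · refine ⟨u, hu, fun j hj => ?_⟩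
          rcases lt_succ'.1 hj with hj | rfl
          exacts [hagree j hj, hodd.symm]
        · intro j hj
          rw [hc j hj, hc k hk]
          constructor
          · rintro ⟨h1, h2⟩
            have : j = k := (hDk j h1).eq_of_not_lt fun hjk => h2 (hagree j hjk).symm
            exact ⟨this, this ▸ h2⟩
          · rintro ⟨rfl, h2⟩
            exact ⟨hkD, h2⟩
      · push Not at hdet
        obtain ⟨w, w', hw, hw', hww', hne⟩ := hdet
        by_cases huk : Elem k u ↔ Elem k v
        · refine ⟨u, hu, fun j hj => ?_⟩
          rcases lt_succ'.1 hj with hj | rfl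
          exacts [hagree j hj, huk]
        · have hc : ∀ i, i < n → (Elem i (code n fun i => xor₃ (Elem i u) (Elem i w) (Elem i w')) ↔
              xor₃ (Elem i u) (Elem i w) (Elem i w')) := fun i hi => by
            rw [elem_code, and_iff_right hi]
          refine ⟨_, hf u w w' _ hu hw hw' isVec_code hc, fun j hj => ?_⟩
          rcases lt_succ'.1 hj with hj | rfl
          · rw [hc j (hj.trans hk), xor₃_of_iff (hww' j hj), hagree j hj]
          · rw [hc j hk, xor₃_of_not_iff (q := Elem j w) (r := Elem j w') (by tauto)]
            exact not_iff.1 huk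
  obtain ⟨u, hu, hagree⟩ := key n le_rfl
  rwa [← (hR.2 u hu).ext hv hagree]

theorem affine_of_preserves (hR : IsVecSet n R) (hf : Preserves xor₃ n R) :
    pair n R ∈ 𝔐.affineRels := by
  refine ⟨n, R, rfl, hR, {e | ∃ D, D < codeBound n ∧ ∃ i, i ≤ 1 ∧ e = pair D i ∧ IsVec n D ∧
    (i = 0 ∨ i = 1) ∧ ∀ v, Elem v R → (OddOn n D v ↔ i = 1)}, setOf_mem_sets,
    ⟨pair (codeBound n) 1 + 1, ?_⟩, ?_, fun v hv => ⟨?_, fun h => ?_⟩⟩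
  · rintro _ ⟨D, hD, i, hi, rfl, -⟩
    exact lt_add_one_iff.2 (pair_le_pair hD.le hi)
  · rintro _ ⟨D, -, i, -, rfl, hD, hi, -⟩
    exact ⟨D, i, rfl, hD.2, hi⟩
  · rintro hvR D i ⟨D', -, i', -, h, -, -, h'⟩
    obtain ⟨rfl, rfl⟩ := pair_inj.1 h
    exact h' v hvR
  · refine mem_of_forall_equation hR hf hv fun D hD p hp => ?_
    by_cases hp' : p
    · have := h D 1 ⟨D, hD.lt, 1, le_rfl, rfl, hD, .inr rfl, fun u hu => by simp [hp u hu, hp']⟩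
      exact this.trans (by simp [hp'])
    · have := h D 0 ⟨D, hD.lt, 0, zero_le, rfl, hD, .inl rfl, fun u hu => by simp [hp u hu, hp']⟩
      exact this.trans (by simp [hp'])

theorem coClone_affineRels : 𝔐.coClone 𝔐.affineRels ⊆ 𝔐.affineRels := by
  rintro r hr
  obtain ⟨n, R, rfl, hR, -⟩ := id hr
  exact affine_of_preserves hR (preserves_of_mem_coClone (fun _ _ => preserves_of_affine) hr)

end affine

end L2Structure

theorem theorem4p1 :
    RCA₀Proves.{u} fun 𝔐 =>
      (∀ S : Set 𝔐, 𝔐.IsSigma01 S → 𝔐.IsCoClone S → (𝔐.RSAT S ↔ 𝔐.LRSAT S)) ∧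
      (𝔐.RSAT 𝔐.affineRels ↔ 𝔐.LRSAT 𝔐.affineRels) ∧
      (𝔐.RSAT 𝔐.bijunctiveRels ↔ 𝔐.LRSAT 𝔐.bijunctiveRels) := by
  intro 𝔐 h𝔐
  have : L2Structure.IsModel 𝔐 := ⟨h𝔐⟩
  exact ⟨fun S _ hS => ⟨L2Structure.lrsat_of_rsat hS.2, L2Structure.rsat_of_lrsat⟩,
    ⟨L2Structure.lrsat_of_rsat L2Structure.coClone_affineRels, L2Structure.rsat_of_lrsat⟩,
    ⟨L2Structure.lrsat_of_rsat L2Structure.coClone_bijunctiveRels, L2Structure.rsat_of_lrsat⟩⟩
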